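/- **Setting.** Let $U\subseteq\mathbb R^4$ be open, with coordinates $(x,v,D,c)$, and let $\mathcal H(U)$ be the space of $C^\infty$ functions $H(x,v,D;c)$ on $U$ with the $C^\infty$ topology (uniform convergence of all derivatives on compact subsets of $U$). For fixed $c$, such an $H$ is an integrable two-degree-of-freedom Hamiltonian on the phase space of points $(x,v,D,\theta)$, $\theta\in\mathbb R/2\pi\mathbb Z$, with equations of motion $\dot x=H_v$, $\dot v=-H_x$, $\dot D=-H_\theta=0$, $\dot\theta=H_D$. A circle $\{(x,v,D)\}\times(\mathbb R/2\pi\mathbb Z)$ is a *circle of fixed points* if it consists of equilibria. It is *normally hyperbolic* (resp. *normally elliptic*) if the linearization of the $(x,v)$-equations at it has no purely imaginary or zero eigenvalue (resp. only purely imaginary non-zero eigenvalues). Put $$F=\{q\in U: H_x=H_v=0\},\qquad T=\{q\in U: H_D=0\},\qquad R=F\cap T,$$ so that the points of $R$ are exactly the circles of fixed points. Call a point $q\in R$ *transverse* if $d(H_x),d(H_v)$ are linearly independent at $q$, $d(H_D)\ne0$ at $q$, $T_qF+T_qT=\mathbb R^4$, and $(T_qF\cap T_qT)+\ker dc=\mathbb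 R^4$; that is, $F$ and $T$ are regular and meet transversally at $q$, and $R$ meets $\{c=\mathrm{const}\}$ transversally at $q$. **Lemma 1.** For every $c_0\in\mathbb R$: 1. For all $H$ in a residual and dense subset of $\mathcal H(U)$: (a) $F$, $T$ and $R$ are embedded smooth submanifolds of $\mathbb R^4$ of dimensions $2$, $3$ and $1$ (possibly empty); $d(H_x),d(H_v)$ are linearly independent along $F$, $d(H_D)\neq 0$ along $T$, and $F$ and $T$ intersect transversally along $R$; every $q\in R$ has a neighbourhood in which all points of $R$ other than possibly $q$ are normally hyperbolic or normally elliptic; (b) for $c=c_0$, and also for Lebesgue-almost every $c\in\mathbb R$, every point of $R$ with parameter value $c$ is transverse, and is normally hyperbolic or normally elliptic. 2. The occurrence of normally hyperbolic circles of fixed points in the systems with $c=c_0$ is a phenomenon of codimension zero: (a) for every $y=(x,v,D)$ with $(y,c_0)\in U$ there is $H\in\mathcal H(U)$ for which $(y,c_0)$ is a transverse point of $R$ and the circle over $y$ is normally hyperbolic; (b) if $(y,c_0)$ is such a point for $H$, then for every neighbourhood $W$ of $y$ all $H'$ in some neighbourhood of $H$ in $\mathcal H(U)$ have such a point $(y',c_0)$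 with $y'\in W$; (c) if $(y,c_0)\in U$ and the circle over $y$ is a normally hyperbolic circle of fixed points of $H(\cdot;c_0)$, then $H$ is a limit point (in the closure) of the set of $H'\in\mathcal H(U)$ for which $(y,c_0)$ is a point as in (a). 3. Statement 2 holds with "normally elliptic" in place of "normally hyperbolic". -/

import Mathlib

open Filter Topology MeasureTheory
open scoped ContDiff

noncomputable section

/-! ### Coordinates -/

/-- The space of points `q = (x, v, D, c)`; the indices `0, 1, 2, 3` stand for `x, v, D, c`. -/
abbrev ParamSpace : Type := EuclideanSpace ℝ (Fin 4)

/-- The space of points `y = (x, v, D)`; the indices `0, 1, 2` stand for `x, v, D`. -/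
abbrev Base : Type := EuclideanSpace ℝ (Fin 3)

/-- The angle variable `θ`. -/
abbrev Angle2Pi : Type := AddCircle (2 * Real.pi)

/-- The four-dimensional phase space, with points `((x, v, D), θ)`. -/
abbrev PhaseSpace : Type := Base × Angle2Pi

/-- The point `(x, v, D, c)`. -/
def joinParam (y : Base) (c : ℝ) : ParamSpace := !₂[y 0, y 1, y 2, c]

/-! ### Hamiltonian dynamics on the phase space -/

/-- The Hamiltonian vector field
`(x', v', D', θ') = (∂K/∂v, -∂K/∂x, -∂K/∂θ, ∂K/∂D)` of a function `K` on the phase space. -/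
def hamiltonianField (K : PhaseSpace → ℝ) (p : PhaseSpace) : Fin 4 → ℝ :=
  ![deriv (fun s : ℝ => K (p.1 + s • EuclideanSpace.single 1 1, p.2)) 0,
    -deriv (fun s : ℝ => K (p.1 + s • EuclideanSpace.single 0 1, p.2)) 0,
    -deriv (fun s : ℝ => K (p.1, p.2 + (s : Angle2Pi))) 0,
    deriv (fun s : ℝ => K (p.1 + s • EuclideanSpace.single 2 1, p.2)) 0]

/-- The matrix of the linearization, at `p`, of the `(x, v)`-part of the Hamiltonian vector field
in the `(x, v)`-plane (`D` and `θ` being frozen). -/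
def normalLinearization (K : PhaseSpace → ℝ) (p : PhaseSpace) : Matrix (Fin 2) (Fin 2) ℝ :=
  Matrix.of fun i j => deriv (fun s : ℝ =>
    hamiltonianField K
      (p.1 + s • EuclideanSpace.single (Fin.castLE (by norm_num) j) 1, p.2)
      (Fin.castLE (by norm_num) i)) 0

/-- The circle `{y} × 𝕋` consists of fixed points of the Hamiltonian flow of `K`. -/
def IsFixedCircle (K : PhaseSpace → ℝ) (y : Base) : Prop :=
  ∀ θ : Angle2Pi, hamiltonianField K (y, θ) = 0

/-- The circle `{y} × 𝕋` is a normally hyperbolic circle of fixed points: no eigenvalue of the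
linearization in the `(x, v)`-plane lies on the imaginary axis. -/
def IsHyperbolicCircle (K : PhaseSpace → ℝ) (y : Base) : Prop :=
  IsFixedCircle K y ∧ ∀ θ : Angle2Pi,
    ∀ μ ∈ spectrum ℂ ((normalLinearization K (y, θ)).map (Complex.ofReal : ℝ → ℂ)), μ.re ≠ 0

/-- The circle `{y} × 𝕋` is a normally elliptic circle of fixed points: all eigenvalues of the
linearization in the `(x, v)`-plane are purely imaginary and non-zero. -/
def IsEllipticCircle (K : PhaseSpace → ℝ) (y : Base) : Prop :=
  IsFixedCircle K y ∧ ∀ θ : Angle2Pi,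
    ∀ μ ∈ spectrum ℂ ((normalLinearization K (y, θ)).map (Complex.ofReal : ℝ → ℂ)),
      μ.re = 0 ∧ μ ≠ 0

/-- The integrable Hamiltonian `(x, v, D, θ) ↦ H(x, v, D; c)` on the phase space. -/
def phaseHamiltonian (H : ParamSpace → ℝ) (c : ℝ) : PhaseSpace → ℝ :=
  fun p => H (joinParam p.1 c)

/-! ### The space of integrable Hamiltonians and genericity -/

/-- Smooth integrable Hamiltonians `H(x, v, D; c)` on a region `U` of the `(x, v, D, c)`-space.
(The values outside `U` are irrelevant, and they do not enter the topology below.) -/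
def IntegrableHam (U : Set ParamSpace) : Type :=
  {H : ParamSpace → ℝ // ContDiffOn ℝ ∞ H U}

/-- The `C^∞` topology: uniform convergence of the derivatives of every order on every compact
subset of `U`. -/
instance IntegrableHam.instTopologicalSpace (U : Set ParamSpace) :
    TopologicalSpace (IntegrableHam U) :=
  ⨅ k : ℕ, TopologicalSpace.induced
    (fun H : IntegrableHam U =>
      UniformOnFun.ofFun {K : Set ParamSpace | IsCompact K ∧ K ⊆ U} (iteratedFDeriv ℝ k H.1))
    inferInstance

/-- A property of integrable Hamiltonians is generic if it holds on a residual, dense set. -/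
def IsGenericProperty {U : Set ParamSpace} (P : IntegrableHam U → Prop) : Prop :=
  {H | P H} ∈ residual (IntegrableHam U) ∧ Dense {H | P H}

/-! ### The surfaces `F`, `T` and the curve `R` -/

/-- The partial derivative in the direction of the `i`-th coordinate of `(x, v, D, c)`. -/
def pderivAt (i : Fin 4) (f : ParamSpace → ℝ) (q : ParamSpace) : ℝ :=
  fderiv ℝ f q (EuclideanSpace.single i 1)

/-- The set `F` of fixed points of the flow in the `(x, v)`-plane: `H_x = H_v = 0`. -/
def surfaceF (U : Set ParamSpace) (H : ParamSpace → ℝ) : Set ParamSpace :=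
  {q ∈ U | pderivAt 0 H q = 0 ∧ pderivAt 1 H q = 0}

/-- The set `T` of points at which `θ' = H_D` vanishes. -/
def surfaceT (U : Set ParamSpace) (H : ParamSpace → ℝ) : Set ParamSpace :=
  {q ∈ U | pderivAt 2 H q = 0}

/-- The intersection `R` of `F` and `T`. -/
def curveR (U : Set ParamSpace) (H : ParamSpace → ℝ) : Set ParamSpace :=
  surfaceF U H ∩ surfaceT U H

/-- `S` is an embedded smooth `k`-dimensional submanifold (without boundary) of the
`(x, v, D, c)`-space: locally it can be straightened to a `k`-dimensional coordinate plane. -/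
def IsEmbeddedSubmanifold (k : ℕ) (S : Set ParamSpace) : Prop :=
  ∀ q ∈ S, ∃ Φ : OpenPartialHomeomorph ParamSpace ParamSpace,
    q ∈ Φ.source ∧ ContDiffOn ℝ ∞ Φ Φ.source ∧ ContDiffOn ℝ ∞ Φ.symm Φ.target ∧
      ∀ p ∈ Φ.source, p ∈ S ↔ ∀ i : Fin 4, k ≤ i.val → Φ p i = 0

/-- The equations `H_x = H_v = 0` of `F` have independent differentials at `q`. -/
def RegularF (H : ParamSpace → ℝ) (q : ParamSpace) : Prop :=
  LinearIndependent ℝ ![fderiv ℝ (pderivAt 0 H) q, fderiv ℝ (pderivAt 1 H) q]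

/-- The equation `H_D = 0` of `T` has a non-zero differential at `q`. -/
def RegularT (H : ParamSpace → ℝ) (q : ParamSpace) : Prop :=
  fderiv ℝ (pderivAt 2 H) q ≠ 0

/-- The tangent space of `F` at a regular point. -/
def tangentF (H : ParamSpace → ℝ) (q : ParamSpace) : Submodule ℝ ParamSpace :=
  (fderiv ℝ (pderivAt 0 H) q).toLinearMap.ker ⊓ (fderiv ℝ (pderivAt 1 H) q).toLinearMap.ker

/-- The tangent space of `T` at a regular point. -/
def tangentT (H : ParamSpace → ℝ) (q : ParamSpace) : Submodule ℝ ParamSpace :=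
  (fderiv ℝ (pderivAt 2 H) q).toLinearMap.ker

/-- The tangent space of a surface `c = const`. -/
def tangentC : Submodule ℝ ParamSpace :=
  (EuclideanSpace.proj (3 : Fin 4) : ParamSpace →L[ℝ] ℝ).toLinearMap.ker

/-- At the point `q` of `R`, the sets `F` and `T` are regular and meet transversally. -/
def TransverseFT (H : ParamSpace → ℝ) (q : ParamSpace) : Prop :=
  RegularF H q ∧ RegularT H q ∧ tangentF H q ⊔ tangentT H q = ⊤

/-- At the point `q` of `R`, the sets `F` and `T` are regular and meet transversally, and the curve
`R`, whose tangent line is then the intersection of the tangent spaces of `F` and `T`, meets the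
surface `c = const` transversally. -/
def TransverseRC (H : ParamSpace → ℝ) (q : ParamSpace) : Prop :=
  TransverseFT H q ∧ (tangentF H q ⊓ tangentT H q) ⊔ tangentC = ⊤

/-! ### The notions of the result -/

/-- Every circle of fixed points of the system with parameter value `c` (in the region `U`) is a
transverse intersection of `R` with `c = const`, and is normally hyperbolic or elliptic. -/
def GoodLevel (U : Set ParamSpace) (H : ParamSpace → ℝ) (c : ℝ) : Prop :=
  ∀ y : Base, joinParam y c ∈ U → IsFixedCircle (phaseHamiltonian H c) y →
    TransverseRC H (joinParam y c) ∧
      (IsHyperbolicCircle (phaseHamiltonian H c) y ∨ IsEllipticCircle (phaseHamiltonian H c) y)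

/-- `F`, `T` and `R` are submanifolds of dimensions 2, 3 and 1, `F` and `T` being cut out by
independent equations and transverse along `R`, and the points of `R` are hyperbolic or elliptic
except for isolated ones. -/
def GoodGeometry (U : Set ParamSpace) (H : ParamSpace → ℝ) : Prop :=
  IsEmbeddedSubmanifold 2 (surfaceF U H) ∧ IsEmbeddedSubmanifold 3 (surfaceT U H) ∧
  IsEmbeddedSubmanifold 1 (curveR U H) ∧
  (∀ q ∈ surfaceF U H, RegularF H q) ∧ (∀ q ∈ surfaceT U H, RegularT H q) ∧
  (∀ q ∈ curveR U H, TransverseFT H q) ∧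
  ∀ q ∈ curveR U H, ∀ᶠ q' in 𝓝[≠] q, q' ∈ curveR U H →
    ∀ (y : Base) (c : ℝ), joinParam y c = q' →
      IsHyperbolicCircle (phaseHamiltonian H c) y ∨ IsEllipticCircle (phaseHamiltonian H c) y

/-- A circle of type `C` at which `R` meets `c = const` transversally. -/
def IsRobustCircle (C : (PhaseSpace → ℝ) → Base → Prop) (U : Set ParamSpace)
    (H : ParamSpace → ℝ) (c : ℝ) (y : Base) : Prop :=
  joinParam y c ∈ U ∧ C (phaseHamiltonian H c) y ∧ TransverseRC H (joinParam y c)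

/-- The occurrence of circles of fixed points of type `C` in the systems with parameter value `c`
is a phenomenon of codimension zero: circles of type `C` that are transverse
intersections of `R` with `c = const` occur at every place of `U`, they persist (close to where they
were) in all sufficiently near systems, and each circle of type `C` becomes such a transverse one
by an arbitrarily small perturbation of the system. -/
def OccursGenerically (C : (PhaseSpace → ℝ) → Base → Prop) (U : Set ParamSpace) (c : ℝ) : Prop :=
  (∀ y : Base, joinParam y c ∈ U → ∃ H : IntegrableHam U, IsRobustCircle C U H.1 c y) ∧
  (∀ (H : IntegrableHam U) (y : Base), IsRobustCircle C U H.1 c y →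
    ∀ W ∈ 𝓝 y, ∀ᶠ H' : IntegrableHam U in 𝓝 H, ∃ y' ∈ W, IsRobustCircle C U H'.1 c y') ∧
  (∀ (H : IntegrableHam U) (y : Base), joinParam y c ∈ U → C (phaseHamiltonian H.1 c) y →
    H ∈ closure {H' : IntegrableHam U | IsRobustCircle C U H'.1 c y})

end

/-! The generic statement is parametric transversality in a finite-dimensional family. Each unwanted
coincidence says that, at a point `q` where certain first partials of `H` vanish, some nonzero
combination `w` of certain rows of the Hessian vanishes on certain coordinate directions. With `w`
normalised to length one this is a system of equations in the eight unknowns `(q, w)`, encoded by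
`degeneracyMap`. Add to `H` a quadratic polynomial: its linear coefficients move the gradient at `q`
freely, and its symmetric matrix `B` moves `w B` freely because `w` is not zero
(`exists_symmetric_mulVec`). Hence the system has zero as a regular value on the whole family, and
for almost every choice of coefficients it has no zeros when there are nine equations
(`ae_no_zero`), and only nondegenerate zeros when there are eight (`ae_nondegenerate`). Both come
from the equal-dimensional Sard theorem, for which class `C^1` suffices.

The nine-equation systems express failure of regularity of `F`, of `T` or of their intersection, or
failure of transversality or of normal nondegeneracy at the level `c₀`. The eight-equation system
expresses that the normal linearization is singular at a point of `R`; its zeros being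
nondegenerate, they are isolated. Almost every arbitrary level is then treated by the same
transversality theorem, with `c` itself as the parameter.

Small coefficients are dense among the good ones, so the nondegenerate Hamiltonians are dense. Over
a compact subset of `U` each condition is open, because `w` also ranges in a compact set; exhausting
`U` by countably many compact sets gives residuality.

The normal linearization has trace zero, so its eigenvalues solve `μ² = -normalDet`: the circle is
hyperbolic or elliptic according to the sign of `normalDet`. This allows one argument, with a sign
`σ`, for both types. At a fixed level, transversality means that the zero `y` of the gradient in
`(x, v, D)` is nondegenerate. Such zeros persist by a quantitative inverse function theorem; they
are produced by a diagonal quadratic form; and a nondegenerate `(x, v)`-block becomes a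
nondegenerate full Hessian after adding a small multiple of the square of the displacement in `D`.
-/

noncomputable section

/-! ### Parametric transversality from the equal-dimensional Sard theorem -/

section Transversality

variable {X Y : Type*} [NormedAddCommGroup X] [NormedSpace ℝ X] [FiniteDimensional ℝ X]
  [NormedAddCommGroup Y] [NormedSpace ℝ Y] [FiniteDimensional ℝ Y]

theorem exists_equiv_of_injective (h : Module.finrank ℝ X = Module.finrank ℝ Y) (L : X →L[ℝ] Y)
    (hL : Function.Injective L) : ∃ e : X ≃L[ℝ] Y, (e : X →L[ℝ] Y) = L := by
  refine ⟨(LinearMap.linearEquivOfInjective L.toLinearMap hL h).toContinuousLinearEquiv, ?_⟩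
  ext x
  simp

/-- The inverse function theorem, with control of the derivatives on the whole chart. -/
theorem exists_chart (h : Module.finrank ℝ X = Module.finrank ℝ Y) {n : ℕ∞ω} (hn1 : 1 ≤ n)
    (hn : n ≠ ω) {O : Set X} (hO : IsOpen O) {f : X → Y} (hf : ContDiffOn ℝ n f O) {p : X}
    (hp : p ∈ O) (hinj : Function.Injective (fderiv ℝ f p)) :
    ∃ e : OpenPartialHomeomorph X Y, p ∈ e.source ∧ e.source ⊆ O ∧ (e : X → Y) = f ∧
      ContDiffOn ℝ n e.symm e.target ∧
      ∀ q ∈ e.source, Function.Injective (fderiv ℝ f q) := by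
  have hn0 : n ≠ 0 := by
    rintro rfl
    simp at hn1
  have hfp : ContDiffAt ℝ n f p := hf.contDiffAt (hO.mem_nhds hp)
  obtain ⟨L, hL⟩ := exists_equiv_of_injective h _ hinj
  have hd : HasFDerivAt f (L : X →L[ℝ] Y) p := by
    rw [hL]
    exact (hfp.differentiableAt hn0).hasFDerivAt
  let e₀ := hfp.toOpenPartialHomeomorph f hd hn0
  have he₀ : (e₀ : X → Y) = f := hfp.toOpenPartialHomeomorph_coe hd hn0
  have hcont : ContinuousOn (fderiv ℝ f) O := hf.continuousOn_fderiv_of_isOpen hO hn1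
  -- Injectivity of the derivative is an open condition; shrinking the chart to where it holds makes
  -- the inverse smooth on the entire target and not just near the image of `p`.
  have hV : IsOpen (O ∩ fderiv ℝ f ⁻¹' {L : X →L[ℝ] Y | Function.Injective L}) :=
    hcont.isOpen_inter_preimage hO ContinuousLinearMap.isOpen_injective
  let e := e₀.restrOpen _ hV
  have hes : e.source = e₀.source ∩ (O ∩ fderiv ℝ f ⁻¹' {L : X →L[ℝ] Y | Function.Injective L}) :=
    e₀.restrOpen_source _ hV
  have he : (e : X → Y) = f := he₀
  refine ⟨e, ?_, ?_, he, ?_, ?_⟩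
  · rw [hes]
    exact ⟨hfp.mem_toOpenPartialHomeomorph_source hd hn0, hp, hinj⟩
  · rw [hes]
    exact fun q hq => hq.2.1
  · intro y hy
    have hq : e.symm y ∈ e.source := e.map_target hy
    rw [hes] at hq
    obtain ⟨L', hL'⟩ := exists_equiv_of_injective h _ hq.2.2
    have hfq : ContDiffAt ℝ n f (e.symm y) := hf.contDiffAt (hO.mem_nhds hq.2.1)
    refine (e.contDiffAt_symm (f₀' := L') hy ?_ ?_).contDiffWithinAt
    · rw [hL', he]
      exact (hfq.differentiableAt hn0).hasFDerivAt
    · rw [he]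
      exact hfq
  · intro q hq
    rw [hes] at hq
    exact hq.2.2

variable {Z A K : Type*} [NormedAddCommGroup Z] [NormedSpace ℝ Z] [FiniteDimensional ℝ Z]
  [NormedAddCommGroup A] [NormedSpace ℝ A] [FiniteDimensional ℝ A]
  [NormedAddCommGroup K] [NormedSpace ℝ K] [FiniteDimensional ℝ K]
  [MeasurableSpace A] [BorelSpace A] (μ : Measure A) [μ.IsAddHaarMeasure]

/-- The set of parameters with a degenerate zero near a given regular zero is null. -/
theorem null_degenerate_near (hdim : Module.finrank ℝ Z = Module.finrank ℝ K)
    {O : Set (Z × A)} (hO : IsOpen O) {G : Z × A → K} (hG : ContDiffOn ℝ 1 G O) {p : Z × A}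
    (hp : p ∈ O) (hs : Function.Surjective (fderiv ℝ G p)) :
    ∃ V ∈ 𝓝 p, μ (Prod.snd '' {q ∈ V | G q = 0 ∧ ∃ ζ : Z, ζ ≠ 0 ∧ fderiv ℝ G q (ζ, 0) = 0}) = 0 := by
  have hker : Module.finrank ℝ (fderiv ℝ G p).toLinearMap.ker = Module.finrank ℝ A := by
    have h1 := (fderiv ℝ G p).toLinearMap.finrank_range_add_finrank_ker
    rw [LinearMap.range_eq_top.2 hs, finrank_top, Module.finrank_prod] at h1
    omega
  -- `T` extends an isomorphism from the kernel of the derivative onto `A`, so that `(G, T)` is a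
  -- local chart at `p`.
  let ε : (fderiv ℝ G p).toLinearMap.ker ≃ₗ[ℝ] A := LinearEquiv.ofFinrankEq _ _ hker
  obtain ⟨T₀, hT₀⟩ := LinearMap.exists_extend ε.toLinearMap
  let T : Z × A →L[ℝ] A := T₀.toContinuousLinearMap
  have hT : ∀ v : Z × A, fderiv ℝ G p v = 0 → T v = 0 → v = 0 := by
    intro v hv hTv
    have h1 : T₀ v = ε ⟨v, hv⟩ := LinearMap.congr_fun hT₀ ⟨v, hv⟩
    have h2 : ε ⟨v, hv⟩ = 0 := by
      rw [← h1]
      exact hTv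
    exact congrArg Subtype.val ((map_eq_zero_iff ε ε.injective).1 h2)
  let f : Z × A → K × A := fun q => (G q, T q)
  have hf : ContDiffOn ℝ 1 f O := hG.prodMk T.contDiff.contDiffOn
  have hdf : ∀ q ∈ O, HasFDerivAt f ((fderiv ℝ G q).prod T) q := fun q hq =>
    (((hG.contDiffAt (hO.mem_nhds hq)).differentiableAt one_ne_zero).hasFDerivAt).prodMk
      T.hasFDerivAt
  have hinj : Function.Injective (fderiv ℝ f p) := by
    rw [(hdf p hp).fderiv, injective_iff_map_eq_zero]
    intro v hv
    simp only [ContinuousLinearMap.prod_apply, Prod.mk_eq_zero] at hv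
    exact hT v hv.1 hv.2
  have hfin : Module.finrank ℝ (Z × A) = Module.finrank ℝ (K × A) := by
    simp [Module.finrank_prod, hdim]
  obtain ⟨e, hpe, heO, hef, -, heinj⟩ := exists_chart hfin le_rfl (by simp) hO hf hp hinj
  refine ⟨e.source, e.open_source.mem_nhds hpe, ?_⟩
  -- In the chart the zero set of `G` is parametrised by the value `κ` of `T`, and `g` is its
  -- projection to the parameter space. Degenerate zeros are to be shown critical points of `g`.
  let g : A → A := fun κ => (e.symm (0, κ)).2
  let S : Set A := {κ | (0, κ) ∈ e.target ∧
    ∃ ζ : Z, ζ ≠ 0 ∧ fderiv ℝ G (e.symm (0, κ)) (ζ, 0) = 0}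
  have hsub : Prod.snd '' {q ∈ e.source | G q = 0 ∧ ∃ ζ : Z, ζ ≠ 0 ∧ fderiv ℝ G q (ζ, 0) = 0} ⊆
      g '' S := by
    rintro _ ⟨q, ⟨hq, hq0, hζ⟩, rfl⟩
    have heq : e q = (0, T q) := by
      rw [hef]
      simp [f, hq0]
    have hsymm : e.symm (0, T q) = q := by
      rw [← heq]
      exact e.left_inv hq
    refine ⟨T q, ⟨?_, ?_⟩, ?_⟩
    · rw [← heq]
      exact e.map_source hq
    · rw [hsymm]
      exact hζ
    · simp only [g, hsymm]
  refine measure_mono_null hsub ?_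
  have key : ∀ κ ∈ S, ∃ g' : A →L[ℝ] A, HasFDerivAt g g' κ ∧ g'.det = 0 := by
    rintro κ ⟨hκ, ζ, hζ0, hζ⟩
    have hq : e.symm (0, κ) ∈ e.source := e.map_target hκ
    obtain ⟨L, hL⟩ := exists_equiv_of_injective hfin _ (heinj _ hq)
    have hd := hdf _ (heO hq)
    rw [hd.fderiv] at hL
    have hsy : HasFDerivAt e.symm (L.symm : K × A →L[ℝ] Z × A) (0, κ) := by
      refine e.hasFDerivAt_symm hκ ?_
      rw [hL, hef]
      exact hd
    have hg : HasFDerivAt g (((ContinuousLinearMap.snd ℝ Z A).comp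
        (L.symm : K × A →L[ℝ] Z × A)).comp (ContinuousLinearMap.inr ℝ K A)) κ :=
      (hsy.snd).comp κ (hasFDerivAt_prodMk_right (0 : K) κ)
    refine ⟨_, hg, ?_⟩
    -- The derivative of `g` sends `T (ζ, 0)` to the parameter component of `(ζ, 0)`, which is zero.
    -- If it were invertible, `T (ζ, 0)` would vanish, and then so would `ζ`.
    by_contra hdet
    have hLζ : L (ζ, 0) = (0, T (ζ, 0)) := by
      have := congrArg (fun l : Z × A →L[ℝ] K × A => l (ζ, 0)) hL
      simpa [hζ] using this
    have hTζ : T (ζ, 0) = 0 := by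
      have hunit := LinearMap.isUnit_iff_isUnit_det _ |>.2 (isUnit_iff_ne_zero.2 hdet)
      have hin : Function.Injective _ := ((Module.End.isUnit_iff _).1 hunit).1
      apply hin
      have : L.symm (0, T (ζ, 0)) = (ζ, 0) := by
        rw [← hLζ, L.symm_apply_apply]
      simp only [ContinuousLinearMap.coe_coe, ContinuousLinearMap.coe_comp, Function.comp_apply,
        ContinuousLinearMap.inr_apply, ContinuousLinearEquiv.coe_coe, this, map_zero]
      rfl
    have : L (ζ, 0) = 0 := by
      rw [hLζ, hTζ]
      rfl
    rw [map_eq_zero_iff L L.injective] at this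
    exact hζ0 (congrArg Prod.fst this)
  choose! g' hg' hdet using key
  exact addHaar_image_eq_zero_of_det_fderivWithin_eq_zero μ
    (fun κ hκ => (hg' κ hκ).hasFDerivWithinAt) hdet

/-- Parametric transversality for as many equations as unknowns: for almost every parameter, all
zeros are nondegenerate. -/
theorem ae_nondegenerate (hdim : Module.finrank ℝ Z = Module.finrank ℝ K)
    {O : Set Z} (hO : IsOpen O) {G : Z × A → K} (hG : ContDiffOn ℝ 1 G (O ×ˢ Set.univ))
    (hs : ∀ z ∈ O, ∀ a, G (z, a) = 0 → Function.Surjective (fderiv ℝ G (z, a))) :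
    ∀ᵐ a ∂μ, ∀ z ∈ O, G (z, a) = 0 → ∀ ζ : Z, fderiv ℝ G (z, a) (ζ, 0) = 0 → ζ = 0 := by
  have hO' : IsOpen (O ×ˢ (Set.univ : Set A)) := hO.prod isOpen_univ
  let S : Set (Z × A) := {q | q.1 ∈ O ∧ G q = 0}
  have hloc : ∀ p ∈ S, ∃ V ∈ 𝓝 p,
      μ (Prod.snd '' {q ∈ V | G q = 0 ∧ ∃ ζ : Z, ζ ≠ 0 ∧ fderiv ℝ G q (ζ, 0) = 0}) = 0 :=
    fun p hp => null_degenerate_near μ hdim hO' hG ⟨hp.1, trivial⟩ (hs p.1 hp.1 p.2 hp.2)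
  choose! V hV hV0 using hloc
  -- By the Lindelöf property countably many of the local neighbourhoods suffice, so the null sets
  -- add up to a null set.
  obtain ⟨t, htS, htc, hcov⟩ := TopologicalSpace.countable_cover_nhdsWithin
    (fun p hp => mem_nhdsWithin_of_mem_nhds (hV p hp))
  rw [ae_iff]
  refine measure_mono_null ?_ ((measure_biUnion_null_iff htc).2 fun p hp => hV0 p (htS hp))
  intro a ha
  simp only [Set.mem_ofPred_eq, not_forall] at ha
  obtain ⟨z, hz, hz0, ζ, hζ, hζ0⟩ := ha
  obtain ⟨p, hp, hzp⟩ := Set.mem_iUnion₂.1 (hcov (show (z, a) ∈ S from ⟨hz, hz0⟩))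
  exact Set.mem_iUnion₂.2 ⟨p, hp, (z, a), ⟨hzp, hz0, ζ, hζ0, hζ⟩, rfl⟩

/-- Parametric transversality for more equations than unknowns: for almost every parameter, there
are no zeros. -/
theorem ae_no_zero (hdim : Module.finrank ℝ Z < Module.finrank ℝ K)
    {O : Set Z} (hO : IsOpen O) {G : Z × A → K} (hG : ContDiffOn ℝ 1 G (O ×ˢ Set.univ))
    (hs : ∀ z ∈ O, ∀ a, G (z, a) = 0 → Function.Surjective (fderiv ℝ G (z, a))) :
    ∀ᵐ a ∂μ, ∀ z ∈ O, G (z, a) ≠ 0 := by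
  obtain ⟨m, hm⟩ := Nat.exists_eq_add_of_lt hdim
  -- Dummy unknowns equalise the dimensions. The equations ignore them, so every zero is degenerate
  -- in a dummy direction, and almost surely there is none.
  let Z' := Z × (Fin (m + 1) → ℝ)
  let π : Z' × A →L[ℝ] Z × A := ((ContinuousLinearMap.fst ℝ Z _).comp
    (ContinuousLinearMap.fst ℝ Z' A)).prod (ContinuousLinearMap.snd ℝ Z' A)
  have hd : ∀ p : Z' × A, p.1.1 ∈ O →
      HasFDerivAt (fun p => G (π p)) ((fderiv ℝ G (π p)).comp π) p := fun p hp =>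
    (((hG.contDiffAt ((hO.prod isOpen_univ).mem_nhds ⟨hp, trivial⟩)).differentiableAt
      one_ne_zero).hasFDerivAt).comp p π.hasFDerivAt
  have h := ae_nondegenerate (Z := Z') μ (O := O ×ˢ Set.univ) (G := fun p => G (π p))
    (by simp [Z', Module.finrank_prod]; omega) (hO.prod isOpen_univ)
    (hG.comp π.contDiff.contDiffOn fun p hp => ⟨hp.1.1, trivial⟩) (by
      intro z hz a h0
      rw [(hd (z, a) hz.1).fderiv]
      refine (hs z.1 hz.1 a h0).comp ?_
      rintro ⟨u, b⟩
      exact ⟨((u, 0), b), rfl⟩)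
  filter_upwards [h] with a ha z hz h0
  have := ha (z, 0) ⟨hz, trivial⟩ h0 (0, 1) (by
    rw [(hd ((z, 0), a) hz).fderiv]
    have : π ((0, 1), 0) = 0 := rfl
    simp [this])
  have h1 := congrFun (congrArg Prod.snd this) 0
  simp at h1

end Transversality

/-! ### Partial derivatives -/

theorem fderiv_apply_eq_sum (f : ParamSpace → ℝ) (q ξ : ParamSpace) :
    fderiv ℝ f q ξ = ∑ k, ξ k * pderivAt k f q := by
  have h : ξ = ∑ k, ξ k • EuclideanSpace.single k (1 : ℝ) := by
    ext i
    simp [Finset.sum_apply, Pi.single_apply]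
  conv_lhs => rw [h]
  simp [pderivAt]

theorem contDiffOn_pderivAt {U : Set ParamSpace} (hU : IsOpen U) {f : ParamSpace → ℝ}
    (hf : ContDiffOn ℝ ∞ f U) (i : Fin 4) : ContDiffOn ℝ ∞ (pderivAt i f) U :=
  (hf.fderiv_of_isOpen hU (by simp)).clm_apply contDiffOn_const

theorem ContDiffOn.differentiableAt_of_isOpen {U : Set ParamSpace} (hU : IsOpen U)
    {f : ParamSpace → ℝ} (hf : ContDiffOn ℝ ∞ f U) {q : ParamSpace} (hq : q ∈ U) :
    DifferentiableAt ℝ f q :=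
  (hf.contDiffAt (hU.mem_nhds hq)).differentiableAt (by simp)

theorem pderivAt_congr {U : Set ParamSpace} (hU : IsOpen U) {f g : ParamSpace → ℝ}
    (h : Set.EqOn f g U) (i : Fin 4) : Set.EqOn (pderivAt i f) (pderivAt i g) U := by
  intro q hq
  simp only [pderivAt]
  rw [(h.eventuallyEq_of_mem (hU.mem_nhds hq)).fderiv_eq]

theorem pderivAt_add {f g : ParamSpace → ℝ} {q : ParamSpace} (hf : DifferentiableAt ℝ f q)
    (hg : DifferentiableAt ℝ g q) (i : Fin 4) :
    pderivAt i (fun p => f p + g p) q = pderivAt i f q + pderivAt i g q := by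
  simp only [pderivAt]
  rw [fderiv_fun_add hf hg]
  rfl

theorem pderivAt_comm {U : Set ParamSpace} (hU : IsOpen U) {f : ParamSpace → ℝ}
    (hf : ContDiffOn ℝ ∞ f U) {q : ParamSpace} (hq : q ∈ U) (i j : Fin 4) :
    pderivAt i (pderivAt j f) q = pderivAt j (pderivAt i f) q := by
  have hd : DifferentiableAt ℝ (fderiv ℝ f) q :=
    ((hf.fderiv_of_isOpen hU (m := ∞) (by simp)).contDiffAt (hU.mem_nhds hq)).differentiableAt
      (by simp)
  have h : ∀ i j, pderivAt i (pderivAt j f) q =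
      fderiv ℝ (fderiv ℝ f) q (EuclideanSpace.single i 1) (EuclideanSpace.single j 1) := by
    intro i j
    have : HasFDerivAt (pderivAt j f)
      ((ContinuousLinearMap.apply ℝ ℝ (EuclideanSpace.single j (1 : ℝ))).comp
        (fderiv ℝ (fderiv ℝ f) q)) q :=
      (ContinuousLinearMap.apply ℝ ℝ (EuclideanSpace.single j (1 : ℝ))).hasFDerivAt.comp q
        hd.hasFDerivAt
    rw [pderivAt, this.fderiv]
    rfl
  rw [h, h]
  exact ((hf.contDiffAt (hU.mem_nhds hq)).isSymmSndFDerivAt (by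
    rw [minSmoothness_of_isRCLikeNormedField]
    exact WithTop.coe_le_coe.2 (le_top (a := (2 : ℕ∞))))).eq _ _

/-- The iterated partial derivative along a list of coordinates. -/
def iterPderiv : List (Fin 4) → (ParamSpace → ℝ) → ParamSpace → ℝ
  | [], f => f
  | i :: l, f => pderivAt i (iterPderiv l f)

/-- The topology is defined through `iteratedFDeriv`, while the equations use partial derivatives;
this links the two. -/
theorem iterPderiv_eq_iteratedFDeriv {U : Set ParamSpace} (hU : IsOpen U) {f : ParamSpace → ℝ}
    (hf : ContDiffOn ℝ ∞ f U) (l : List (Fin 4)) {q : ParamSpace} (hq : q ∈ U) :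
    iterPderiv l f q =
      iteratedFDeriv ℝ l.length f q (fun t => EuclideanSpace.single (l.get t) (1 : ℝ)) := by
  induction l generalizing q with
  | nil => simp [iterPderiv]
  | cons i l ih =>
    have hd : DifferentiableAt ℝ (iteratedFDeriv ℝ l.length f) q :=
      (hf.contDiffAt (hU.mem_nhds hq)).differentiableAt_iteratedFDeriv (by
        exact_mod_cast WithTop.coe_lt_coe.2 (ENat.natCast_lt_top _))
    have h := hd.iteratedFDeriv_succ_apply_left'
      (m := fun t => EuclideanSpace.single ((i :: l).get t) (1 : ℝ))
    refine Eq.trans ?_ h.symm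
    rw [iterPderiv, pderivAt_congr hU (fun p hp => ih hp) i hq]
    rfl

/-! ### Joint continuity of the derivatives -/

variable {U : Set ParamSpace}

theorem IntegrableHam.tendstoUniformlyOn (H : IntegrableHam U) (k : ℕ) {K : Set ParamSpace}
    (hK : IsCompact K) (hKU : K ⊆ U) :
    TendstoUniformlyOn (fun H' : IntegrableHam U => iteratedFDeriv ℝ k H'.1)
      (iteratedFDeriv ℝ k H.1) (𝓝 H) K := by
  have h : Continuous (fun H : IntegrableHam U =>
      UniformOnFun.ofFun {K : Set ParamSpace | IsCompact K ∧ K ⊆ U}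
        (iteratedFDeriv ℝ k H.1)) :=
    continuous_iInf_dom (i := k) continuous_induced_dom
  exact UniformOnFun.tendsto_iff_tendstoUniformlyOn.1 (h.tendsto H) K ⟨hK, hKU⟩

/-- Uniform convergence on a closed ball around `q` controls the change of Hamiltonian, and
continuity of the derivative of the fixed `H` controls the change of point. -/
theorem continuousAt_iteratedFDeriv (hU : IsOpen U) (k : ℕ) (H : IntegrableHam U)
    {q : ParamSpace} (hq : q ∈ U) :
    ContinuousAt (fun p : IntegrableHam U × ParamSpace => iteratedFDeriv ℝ k p.1.1 p.2)
      (H, q) := by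
  obtain ⟨r, hr, hrU⟩ := Metric.nhds_basis_closedBall.mem_iff.1 (hU.mem_nhds hq)
  have h1 := H.tendstoUniformlyOn k (isCompact_closedBall q r) hrU
  have h2 : ContinuousAt (iteratedFDeriv ℝ k H.1) q :=
    ((H.2.contDiffAt (hU.mem_nhds hq)).differentiableAt_iteratedFDeriv (by
        exact_mod_cast WithTop.coe_lt_coe.2 (ENat.natCast_lt_top _))).continuousAt
  rw [Metric.tendstoUniformlyOn_iff] at h1
  rw [ContinuousAt, Metric.tendsto_nhds]
  intro ε hε
  have h3 := Metric.tendsto_nhds.1 h2 (ε / 2) (by positivity)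
  rw [nhds_prod_eq]
  filter_upwards [(h1 (ε / 2) (by positivity)).prod_mk
    (h3.and (Metric.closedBall_mem_nhds q hr))] with p hp
  have := hp.1 p.2 hp.2.2
  rw [dist_comm] at this
  linarith [dist_triangle (iteratedFDeriv ℝ k p.1.1 p.2) (iteratedFDeriv ℝ k H.1 p.2)
    (iteratedFDeriv ℝ k H.1 q), hp.2.1]

theorem continuousOn_iterPderiv (hU : IsOpen U) (l : List (Fin 4)) :
    ContinuousOn (fun p : IntegrableHam U × ParamSpace => iterPderiv l p.1.1 p.2)
      {p | p.2 ∈ U} := by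
  rintro ⟨H, q⟩ hq
  have h : ContinuousAt (fun p : IntegrableHam U × ParamSpace =>
      iteratedFDeriv ℝ l.length p.1.1 p.2 (fun t => EuclideanSpace.single (l.get t) (1 : ℝ)))
      (H, q) :=
    (ContinuousMultilinearMap.apply ℝ (fun _ : Fin l.length => ParamSpace) ℝ
      (fun t => EuclideanSpace.single (l.get t) (1 : ℝ))).continuous.continuousAt.comp
      (continuousAt_iteratedFDeriv hU _ H hq)
  refine (h.continuousWithinAt).congr (fun p hp => ?_) ?_
  · exact iterPderiv_eq_iteratedFDeriv hU p.1.2 l hp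
  · exact iterPderiv_eq_iteratedFDeriv hU H.2 l hq

/-! ### Quadratic perturbations -/

/-- The coefficients of a quadratic polynomial. -/
abbrev QuadCoeff : Type := (Fin 4 → ℝ) × (Fin 4 → Fin 4 → ℝ)

/-- The polynomial with given linear and quadratic coefficients. -/
def quadPoly (a : QuadCoeff) (q : ParamSpace) : ℝ :=
  ∑ i, a.1 i * q i + ∑ i, ∑ j, a.2 i j / 2 * q i * q j

theorem contDiff_quadPoly_uncurry :
    ContDiff ℝ ∞ (fun p : QuadCoeff × ParamSpace => quadPoly p.1 p.2) := by
  unfold quadPoly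
  fun_prop

theorem contDiff_quadPoly (a : QuadCoeff) : ContDiff ℝ ∞ (quadPoly a) := by
  unfold quadPoly
  fun_prop

theorem pderivAt_quadPoly (a : QuadCoeff) (i : Fin 4) (q : ParamSpace) :
    pderivAt i (quadPoly a) q = a.1 i + ∑ j, (a.2 i j + a.2 j i) / 2 * q j := by
  have h : ∀ j, HasFDerivAt (fun q : ParamSpace => q j)
      (EuclideanSpace.proj j : ParamSpace →L[ℝ] ℝ) q :=
    fun j => (EuclideanSpace.proj j : ParamSpace →L[ℝ] ℝ).hasFDerivAt
  have h1 : HasFDerivAt (quadPoly a) _ q :=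
    (HasFDerivAt.fun_sum (u := Finset.univ) fun i _ => (h i).const_mul (a.1 i)).add
      (HasFDerivAt.fun_sum (u := Finset.univ) fun i _ => HasFDerivAt.fun_sum (u := Finset.univ)
        fun j _ => ((h i).const_mul (a.2 i j / 2)).mul (h j))
  rw [pderivAt, h1.fderiv]
  simp only [add_apply, sum_apply, smul_apply,
    PiLp.proj_apply, PiLp.single_apply, smul_eq_mul, mul_ite, mul_one, mul_zero,
    Finset.sum_add_distrib, Finset.sum_ite_eq', Finset.mem_univ, if_true, add_div, add_mul]
  rw [add_right_inj]
  rw [Finset.sum_comm]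
  simp [mul_comm, add_comm]

theorem pderivAt_pderivAt_quadPoly (a : QuadCoeff) (i j : Fin 4) (q : ParamSpace) :
    pderivAt j (pderivAt i (quadPoly a)) q = (a.2 i j + a.2 j i) / 2 := by
  have h : ∀ j, HasFDerivAt (fun q : ParamSpace => q j)
      (EuclideanSpace.proj j : ParamSpace →L[ℝ] ℝ) q :=
    fun j => (EuclideanSpace.proj j : ParamSpace →L[ℝ] ℝ).hasFDerivAt
  have h1 := (HasFDerivAt.fun_sum (u := Finset.univ)
      fun j _ => (h j).const_mul ((a.2 i j + a.2 j i) / 2)).const_add (a.1 i)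
  rw [show pderivAt i (quadPoly a) = fun q => a.1 i + ∑ j, (a.2 i j + a.2 j i) / 2 * q j from
    funext fun q => pderivAt_quadPoly a i q, pderivAt, h1.fderiv]
  simp

/-- The Hamiltonian with a quadratic polynomial added. -/
def IntegrableHam.addQuad (H : IntegrableHam U) (a : QuadCoeff) : IntegrableHam U :=
  ⟨fun q => H.1 q + quadPoly a q, H.2.add (contDiff_quadPoly a).contDiffOn⟩

theorem IntegrableHam.pderivAt_addQuad (hU : IsOpen U) (H : IntegrableHam U) (a : QuadCoeff)
    (i : Fin 4) {q : ParamSpace} (hq : q ∈ U) :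
    pderivAt i (H.addQuad a).1 q =
      pderivAt i H.1 q + (a.1 i + ∑ j, (a.2 i j + a.2 j i) / 2 * q j) := by
  rw [← pderivAt_quadPoly]
  exact pderivAt_add (H.2.differentiableAt_of_isOpen hU hq)
    ((contDiff_quadPoly a).differentiable (by simp) q) i

theorem IntegrableHam.pderivAt_pderivAt_addQuad (hU : IsOpen U) (H : IntegrableHam U)
    (a : QuadCoeff) (i j : Fin 4) {q : ParamSpace} (hq : q ∈ U) :
    pderivAt j (pderivAt i (H.addQuad a).1) q =
      pderivAt j (pderivAt i H.1) q + (a.2 i j + a.2 j i) / 2 := by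
  have h1 := contDiffOn_pderivAt hU H.2 i
  have h2 := contDiffOn_pderivAt isOpen_univ (contDiff_quadPoly a).contDiffOn i
  rw [← pderivAt_pderivAt_quadPoly a i j q, ← pderivAt_add (h1.differentiableAt_of_isOpen hU hq)
    (h2.differentiableAt_of_isOpen isOpen_univ trivial) j]
  refine pderivAt_congr hU (fun p hp => ?_) j hq
  exact pderivAt_add (H.2.differentiableAt_of_isOpen hU hp)
    ((contDiff_quadPoly a).differentiable (by simp) p) i

theorem IntegrableHam.tendsto_nhds {ι : Type*} {l : Filter ι} {F : ι → IntegrableHam U}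
    {H : IntegrableHam U} (h : ∀ (k : ℕ) (K : Set ParamSpace), IsCompact K → K ⊆ U →
      TendstoUniformlyOn (fun a => iteratedFDeriv ℝ k (F a).1) (iteratedFDeriv ℝ k H.1) l K) :
    Tendsto F l (𝓝 H) := by
  rw [nhds_iInf, tendsto_iInf]
  intro k
  rw [nhds_induced, tendsto_comap_iff]
  exact UniformOnFun.tendsto_iff_tendstoUniformlyOn.2 fun K hK => h k K hK.1 hK.2

/-- Viewing the derivative in `q` as a restriction of the joint derivative in `(a, q)` makes it
visibly continuous in both variables. -/
theorem iteratedFDeriv_quadPoly (k : ℕ) (a : QuadCoeff) (q : ParamSpace) :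
    iteratedFDeriv ℝ k (quadPoly a) q =
      (iteratedFDeriv ℝ k (fun p : QuadCoeff × ParamSpace => quadPoly p.1 p.2)
        (a, q)).compContinuousLinearMap fun _ => ContinuousLinearMap.inr ℝ QuadCoeff ParamSpace := by
  have hg : ContDiff ℝ ∞
      (fun p : QuadCoeff × ParamSpace => quadPoly ((a, 0) + p).1 ((a, 0) + p).2) :=
    contDiff_quadPoly_uncurry.comp (contDiff_const.add contDiff_id)
  have h := (ContinuousLinearMap.inr ℝ QuadCoeff ParamSpace).iteratedFDeriv_comp_right hg q
    (i := k) (by exact_mod_cast le_top)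
  rw [iteratedFDeriv_comp_add_left (f := fun p : QuadCoeff × ParamSpace => quadPoly p.1 p.2)] at h
  simpa [Function.comp_def] using h

theorem IntegrableHam.tendsto_addQuad (hU : IsOpen U) (H : IntegrableHam U) :
    Tendsto H.addQuad (𝓝 0) (𝓝 H) := by
  refine IntegrableHam.tendsto_nhds fun k K hK hKU => ?_
  rw [Metric.tendstoUniformlyOn_iff]
  intro ε hε
  have hcont : Continuous fun p : QuadCoeff × ParamSpace => iteratedFDeriv ℝ k (quadPoly p.1) p.2 := by
    simp_rw [iteratedFDeriv_quadPoly]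
    exact (ContinuousMultilinearMap.compContinuousLinearMapL
      (fun _ : Fin k => ContinuousLinearMap.inr ℝ QuadCoeff ParamSpace)).continuous.comp
      (contDiff_quadPoly_uncurry.continuous_iteratedFDeriv (by exact_mod_cast le_top))
  have h0 : quadPoly 0 = fun _ => 0 := by
    funext q
    simp [quadPoly]
  -- Compactness of `K` turns joint continuity at the zero polynomial into smallness uniform over
  -- `K`.
  have hev := hK.eventually_forall_of_forall_eventually (x₀ := (0 : QuadCoeff))
    (P := fun a q => ‖iteratedFDeriv ℝ k (quadPoly a) q‖ < ε) fun q _ => by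
      refine hcont.norm.continuousAt.eventually_lt continuousAt_const ?_
      simpa [h0] using hε
  filter_upwards [hev] with a ha q hq
  have hadd : iteratedFDeriv ℝ k (H.addQuad a).1 q =
      iteratedFDeriv ℝ k H.1 q + iteratedFDeriv ℝ k (quadPoly a) q :=
    iteratedFDeriv_add_apply ((H.2.contDiffAt (hU.mem_nhds (hKU hq))).of_le
      (by exact_mod_cast le_top)) ((contDiff_quadPoly a).contDiffAt.of_le (by exact_mod_cast le_top))
  rw [dist_comm, dist_eq_norm, hadd, add_sub_cancel_left]
  exact ha q hq

/-! ### The defining equations of degenerate points -/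

/-- A point `q` together with a covector `w` on the components of the gradient. -/
abbrev PointVec : Type := ParamSpace × (Fin 4 → ℝ)

/-- The values of the equations of `degeneracyMap`. -/
abbrev DegValue (I A J C : Finset (Fin 4)) : Type :=
  (({i // i ∉ I} → ℝ) × ℝ × ({i // i ∈ C} → ℝ)) × (({i // i ∈ A} → ℝ) × ({i // i ∈ J} → ℝ))

/-- The equations for a unit vector `w` supported in `I` and a point `q` with `q i = c` for `i ∈ C`,
such that the partial derivatives of `f` with indices in `A` vanish at `q` and the combination, with
coefficients `w`, of the differentials of the partial derivatives of `f` vanishes on the coordinate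
directions of `J`. -/
def degeneracyMap (I A J C : Finset (Fin 4)) (c : ℝ) (f : ParamSpace → ℝ) (z : PointVec) :
    DegValue I A J C :=
  ((fun i => z.2 i, ∑ i, z.2 i ^ 2 - 1, fun i => z.1 i - c),
    (fun i => pderivAt i f z.1, fun j => ∑ i, z.2 i * pderivAt j (pderivAt i f) z.1))

theorem degeneracyMap_eq_zero_iff {I A J C : Finset (Fin 4)} {c : ℝ} {f : ParamSpace → ℝ}
    {z : PointVec} : degeneracyMap I A J C c f z = 0 ↔
      (∀ i ∉ I, z.2 i = 0) ∧ ∑ i, z.2 i ^ 2 = 1 ∧ (∀ i ∈ C, z.1 i = c) ∧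
      (∀ i ∈ A, pderivAt i f z.1 = 0) ∧ ∀ j ∈ J, ∑ i, z.2 i * pderivAt j (pderivAt i f) z.1 = 0 := by
  simp only [degeneracyMap, Prod.ext_iff, Prod.fst_zero, Prod.snd_zero, funext_iff, Pi.zero_apply,
    Subtype.forall, sub_eq_zero, and_assoc]

/-- The derivative is block triangular: some parameter directions reach every vector of the second
factor without moving the first, and the variable `z` alone covers the first. This is why `DegValue`
groups the equations not involving `f` in its first factor. -/
theorem surjective_fderiv_of_partial {Z A K₁ K₂ : Type*}
    [NormedAddCommGroup Z] [NormedSpace ℝ Z] [NormedAddCommGroup A] [NormedSpace ℝ A]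
    [NormedAddCommGroup K₁] [NormedSpace ℝ K₁] [NormedAddCommGroup K₂] [NormedSpace ℝ K₂]
    {G : Z × A → K₁ × K₂} {z : Z} {a : A} (hd : DifferentiableAt ℝ G (z, a))
    (h₁ : ∀ k, ∃ ζ, HasDerivAt (fun t : ℝ => (G (z + t • ζ, a)).1) k 0)
    (h₂ : ∀ k, ∃ α, HasDerivAt (fun t : ℝ => G (z, a + t • α)) (0, k) 0) :
    Function.Surjective (fderiv ℝ G (z, a)) := by
  have hline : ∀ v : Z × A, HasDerivAt (fun t : ℝ => G ((z, a) + t • v)) (fderiv ℝ G (z, a) v) 0 := by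
    intro v
    have h1 : HasDerivAt (fun t : ℝ => (z, a) + t • v) v 0 := by
      simpa using ((hasDerivAt_id (0 : ℝ)).smul_const v).const_add (z, a)
    have h2 : HasFDerivAt G (fderiv ℝ G (z, a)) ((z, a) + (0 : ℝ) • v) := by
      simpa using hd.hasFDerivAt
    exact h2.comp_hasDerivAt (0 : ℝ) h1
  rintro ⟨k₁, k₂⟩
  obtain ⟨ζ, hζ⟩ := h₁ k₁
  have e1 : (fderiv ℝ G (z, a) (ζ, 0)).1 = k₁ := by
    have h := ((ContinuousLinearMap.fst ℝ K₁ K₂).hasFDerivAt.comp_hasDerivAt (0 : ℝ) (hline (ζ, 0)))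
    refine h.unique (hζ.congr_of_eventuallyEq (Eventually.of_forall fun t => ?_))
    simp
  obtain ⟨α, hα⟩ := h₂ (k₂ - (fderiv ℝ G (z, a) (ζ, 0)).2)
  have e2 : fderiv ℝ G (z, a) (0, α) = (0, k₂ - (fderiv ℝ G (z, a) (ζ, 0)).2) := by
    refine (hline (0, α)).unique (hα.congr_of_eventuallyEq (Eventually.of_forall fun t => ?_))
    simp
  refine ⟨(ζ, 0) + (0, α), ?_⟩
  rw [map_add, e2]
  ext <;> simp [e1]

/-- The map `degeneracyMap` for a quadratic perturbation, as a function of the perturbation. -/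
def degeneracyFamily (I A J C : Finset (Fin 4)) (c : ℝ) (f : ParamSpace → ℝ)
    (p : PointVec × QuadCoeff) : DegValue I A J C :=
  ((fun i => p.1.2 i, ∑ i, p.1.2 i ^ 2 - 1, fun i => p.1.1 i - c),
    (fun i => pderivAt i f p.1.1 + (p.2.1 i + ∑ j, (p.2.2 i j + p.2.2 j i) / 2 * p.1.1 j),
      fun j => ∑ i, p.1.2 i * (pderivAt j (pderivAt i f) p.1.1 + (p.2.2 i j + p.2.2 j i) / 2)))

theorem degeneracyFamily_eq (hU : IsOpen U) (I A J C : Finset (Fin 4)) (c : ℝ)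
    (H : IntegrableHam U) (z : PointVec) (hz : z.1 ∈ U) (a : QuadCoeff) :
    degeneracyFamily I A J C c H.1 (z, a) = degeneracyMap I A J C c (H.addQuad a).1 z := by
  simp only [degeneracyFamily, degeneracyMap, H.pderivAt_addQuad hU a _ hz,
    H.pderivAt_pderivAt_addQuad hU a _ _ hz]

theorem contDiffOn_degeneracyFamily (hU : IsOpen U) (I A J C : Finset (Fin 4)) (c : ℝ)
    {f : ParamSpace → ℝ} (hf : ContDiffOn ℝ ∞ f U) :
    ContDiffOn ℝ 1 (degeneracyFamily I A J C c f) ((U ×ˢ Set.univ) ×ˢ Set.univ) := by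
  have h1 : ∀ i, ContDiffOn ℝ 1 (fun p : PointVec × QuadCoeff => pderivAt i f p.1.1)
      ((U ×ˢ Set.univ) ×ˢ Set.univ) := fun i =>
    ((contDiffOn_pderivAt hU hf i).of_le (by exact_mod_cast le_top)).comp
      (contDiff_fst.comp contDiff_fst).contDiffOn fun p hp => hp.1.1
  have h2 : ∀ i j, ContDiffOn ℝ 1 (fun p : PointVec × QuadCoeff => pderivAt j (pderivAt i f) p.1.1)
      ((U ×ˢ Set.univ) ×ˢ Set.univ) := fun i j =>
    ((contDiffOn_pderivAt hU (contDiffOn_pderivAt hU hf i) j).of_le (by exact_mod_cast le_top)).comp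
      (contDiff_fst.comp contDiff_fst).contDiffOn fun p hp => hp.1.1
  refine ContDiffOn.prodMk (ContDiff.contDiffOn (by fun_prop)) (ContDiffOn.prodMk ?_ ?_)
  · refine contDiffOn_pi.2 fun i => (h1 i).add (ContDiff.contDiffOn (by fun_prop))
  · refine contDiffOn_pi.2 fun j => ContDiffOn.sum fun i _ => ContDiffOn.mul
      (ContDiff.contDiffOn (by fun_prop)) ((h2 i j).add (ContDiff.contDiffOn (by fun_prop)))

theorem exists_symmetric_mulVec {w : Fin 4 → ℝ} (hw : ∑ i, w i ^ 2 = 1) (f : Fin 4 → ℝ) :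
    ∃ B : Fin 4 → Fin 4 → ℝ, ∀ j, ∑ i, w i * ((B i j + B j i) / 2) = f j := by
  -- The matrix `f wᵀ + w fᵀ - (f · w) w wᵀ` is symmetric; applied to the unit vector `w`, the last
  -- term cancels the unwanted multiple of `w`.
  refine ⟨fun i j => f i * w j + w i * f j - (∑ k, f k * w k) * (w i * w j), fun j => ?_⟩
  simp only [Fin.sum_univ_four] at hw ⊢
  linear_combination (f j) * hw + (-(f 0 * w 0 + f 1 * w 1 + f 2 * w 2 + f 3 * w 3) * w j) * (hw)

theorem surjective_fderiv_degeneracyFamily (hU : IsOpen U) (I A J C : Finset (Fin 4)) (c : ℝ)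
    {f : ParamSpace → ℝ} (hf : ContDiffOn ℝ ∞ f U) (z : PointVec) (hz : z.1 ∈ U) (a : QuadCoeff)
    (h0 : degeneracyFamily I A J C c f (z, a) = 0) :
    Function.Surjective (fderiv ℝ (degeneracyFamily I A J C c f) (z, a)) := by
  have hI : ∀ i ∉ I, z.2 i = 0 := fun i hi => congrFun (congrArg (fun k => k.1.1) h0) ⟨i, hi⟩
  have hw : ∑ i, z.2 i ^ 2 = 1 := sub_eq_zero.1 (congrArg (fun k => k.1.2.1) h0)
  refine surjective_fderiv_of_partial
    (((contDiffOn_degeneracyFamily hU I A J C c hf).contDiffAt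
      (((hU.prod isOpen_univ).prod isOpen_univ).mem_nhds ⟨⟨hz, trivial⟩, trivial⟩)).differentiableAt
        one_ne_zero) ?_ ?_
  · rintro ⟨u, r, p⟩
    -- The entries outside `I` are prescribed. The radial part `r / 2 * w` changes the squared
    -- length at rate `r`, since `w` has length one and vanishes outside `I`.
    let υ : Fin 4 → ℝ := fun i => if hi : i ∉ I then u ⟨i, hi⟩ else r / 2 * z.2 i
    let ξ : ParamSpace := WithLp.toLp 2 fun i => if hi : i ∈ C then p ⟨i, hi⟩ else 0
    refine ⟨(ξ, υ), ?_⟩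
    have hlin : ∀ x y : ℝ, HasDerivAt (fun t : ℝ => x + t * y) y 0 := fun x y => by
      simpa using ((hasDerivAt_id (0 : ℝ)).mul_const y).const_add x
    refine HasDerivAt.prodMk (hasDerivAt_pi.2 fun i => ?_) (HasDerivAt.prodMk ?_
      (hasDerivAt_pi.2 fun i => ?_))
    · have : υ i = u i := by simp [υ, i.2]
      rw [← this]
      exact hlin _ _
    · have h1 : HasDerivAt (fun t : ℝ => ∑ i, (z.2 i + t * υ i) ^ 2 - 1)
          (∑ i, 2 * z.2 i * υ i) 0 := by
        refine HasDerivAt.sub_const _ (HasDerivAt.fun_sum fun i _ => ?_)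
        simpa using (hlin (z.2 i) (υ i)).fun_pow 2
      have h2 : ∑ i, 2 * z.2 i * υ i = r := by
        have : ∀ i, 2 * z.2 i * υ i = r * z.2 i ^ 2 := by
          intro i
          by_cases hi : i ∈ I
          · simp only [υ, hi, not_true_eq_false, dite_false]
            ring
          · simp [hI i hi]
        simp_rw [this]
        rw [← Finset.mul_sum, hw, mul_one]
      rw [← h2]
      exact h1
    · have : ξ i = p i := by simp [ξ]
      rw [← this]
      exact (hlin _ _).sub_const c
  · rintro ⟨u, v⟩
    obtain ⟨B, hB⟩ := exists_symmetric_mulVec hw fun j => if hj : j ∈ J then v ⟨j, hj⟩ else 0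
    -- The linear part also cancels the gradient which the quadratic part `B` creates at the point.
    let b : Fin 4 → ℝ := fun i =>
      (if hi : i ∈ A then u ⟨i, hi⟩ else 0) - ∑ j, (B i j + B j i) / 2 * z.1 j
    refine ⟨(b, B), ?_⟩
    have hG : ∀ t : ℝ, degeneracyFamily I A J C c f (z, a + t • (b, B)) =
        degeneracyFamily I A J C c f (z, a) + t • ((0, (u, v)) : DegValue I A J C) := by
      intro t
      refine Prod.ext (by simp [degeneracyFamily]) (Prod.ext (funext fun i => ?_)
        (funext fun j => ?_))
      · have : b i = u i - ∑ j, (B i j + B j i) / 2 * z.1 j := by simp [b]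
        simp only [degeneracyFamily, Prod.fst_add, Prod.snd_add, Prod.smul_fst, Prod.smul_snd,
          Pi.add_apply, Pi.smul_apply, smul_eq_mul, this, Fin.sum_univ_four]
        ring
      · have : v j = ∑ i, z.2 i * ((B i j + B j i) / 2) := by simp [hB]
        simp only [degeneracyFamily, Prod.fst_add, Prod.snd_add, Prod.smul_fst, Prod.smul_snd,
          Pi.add_apply, Pi.smul_apply, smul_eq_mul, this, Fin.sum_univ_four]
        ring
    simp_rw [hG]
    simpa using ((hasDerivAt_id (0 : ℝ)).smul_const
      ((0, (u, v)) : DegValue I A J C)).const_add (degeneracyFamily I A J C c f (z, a))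

theorem finrank_degValue (I A J C : Finset (Fin 4)) :
    Module.finrank ℝ (DegValue I A J C) = (Iᶜ.card + (1 + C.card)) + (A.card + J.card) := by
  simp [DegValue, Module.finrank_prod, Module.finrank_fintype_fun_eq_card, Finset.card_compl,
    Fintype.card_subtype_compl]

theorem finrank_pointVec : Module.finrank ℝ PointVec = 8 := by
  simp [PointVec, Module.finrank_prod]

/-- For almost every quadratic perturbation, an overdetermined degeneracy does not occur. -/
theorem ae_degeneracyMap_ne_zero (hU : IsOpen U) (I A J C : Finset (Fin 4)) (c : ℝ)
    (H : IntegrableHam U) (hdim : 8 < (Iᶜ.card + (1 + C.card)) + (A.card + J.card)) :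
    ∀ᵐ a ∂(Measure.addHaar : Measure QuadCoeff), ∀ z : PointVec, z.1 ∈ U →
      degeneracyMap I A J C c (H.addQuad a).1 z ≠ 0 := by
  have h := ae_no_zero (Measure.addHaar : Measure QuadCoeff) (by rwa [finrank_pointVec, finrank_degValue])
    (hU.prod isOpen_univ) (contDiffOn_degeneracyFamily hU I A J C c H.2)
    fun z hz a => surjective_fderiv_degeneracyFamily hU I A J C c H.2 z hz.1 a
  filter_upwards [h] with a ha z hz
  rw [← degeneracyFamily_eq hU I A J C c H z hz a]
  exact ha z ⟨hz, trivial⟩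

/-- For almost every quadratic perturbation, a degeneracy given by as many equations as unknowns
occurs at regular zeros only. -/
theorem ae_degeneracyMap_regular (hU : IsOpen U) (I A J C : Finset (Fin 4)) (c : ℝ)
    (H : IntegrableHam U) (hdim : 8 = (Iᶜ.card + (1 + C.card)) + (A.card + J.card)) :
    ∀ᵐ a ∂(Measure.addHaar : Measure QuadCoeff), ∀ z : PointVec, z.1 ∈ U →
      degeneracyMap I A J C c (H.addQuad a).1 z = 0 → ∀ ζ, fderiv ℝ (degeneracyMap I A J C c (H.addQuad a).1) z ζ = 0 → ζ = 0 := by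
  have hO : IsOpen (U ×ˢ (Set.univ : Set (Fin 4 → ℝ))) := hU.prod isOpen_univ
  have h := ae_nondegenerate (Measure.addHaar : Measure QuadCoeff)
    (by rwa [finrank_pointVec, finrank_degValue])
    hO (contDiffOn_degeneracyFamily hU I A J C c H.2)
    fun z hz a => surjective_fderiv_degeneracyFamily hU I A J C c H.2 z hz.1 a
  filter_upwards [h] with a ha z hz h0 ζ hζ
  refine ha z ⟨hz, trivial⟩ (by rwa [degeneracyFamily_eq hU I A J C c H z hz a]) ζ ?_
  have hd : HasFDerivAt (degeneracyFamily I A J C c H.1)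
      (fderiv ℝ (degeneracyFamily I A J C c H.1) (z, a)) (z, a) :=
    (((contDiffOn_degeneracyFamily hU I A J C c H.2).contDiffAt
      ((hO.prod isOpen_univ).mem_nhds ⟨⟨hz, trivial⟩, trivial⟩)).differentiableAt
        one_ne_zero).hasFDerivAt
  have hd' := HasFDerivAt.comp (f := fun z => (z, a)) z hd (hasFDerivAt_prodMk_left z a)
  have heq : degeneracyMap I A J C c (H.addQuad a).1 =ᶠ[𝓝 z]
      (degeneracyFamily I A J C c H.1 ∘ fun z => (z, a)) := by
    filter_upwards [hO.mem_nhds ⟨hz, trivial⟩] with z' hz'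
    exact (degeneracyFamily_eq hU I A J C c H z' hz'.1 a).symm
  rw [heq.fderiv_eq, hd'.fderiv] at hζ
  exact hζ

/-! ### Open and dense sets of Hamiltonians without degeneracies -/

theorem continuousOn_pderivAt_joint (hU : IsOpen U) (i : Fin 4) :
    ContinuousOn (fun p : IntegrableHam U × ParamSpace => pderivAt i p.1.1 p.2) {p | p.2 ∈ U} :=
  continuousOn_iterPderiv hU [i]

theorem continuousOn_pderivAt_pderivAt_joint (hU : IsOpen U) (i j : Fin 4) :
    ContinuousOn (fun p : IntegrableHam U × ParamSpace => pderivAt j (pderivAt i p.1.1) p.2)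
      {p | p.2 ∈ U} :=
  continuousOn_iterPderiv hU [j, i]

theorem continuousOn_degeneracyMap (hU : IsOpen U) (I A J C : Finset (Fin 4)) (c : ℝ) :
    ContinuousOn (fun p : IntegrableHam U × PointVec => degeneracyMap I A J C c p.1.1 p.2)
      {p | p.2.1 ∈ U} := by
  have hφ : ContinuousOn (fun p : IntegrableHam U × PointVec => (p.1, p.2.1)) {p | p.2.1 ∈ U} :=
    Continuous.continuousOn (by fun_prop)
  refine ContinuousOn.prodMk (Continuous.continuousOn (by fun_prop)) (ContinuousOn.prodMk
    (continuousOn_pi.2 fun i => ?_) (continuousOn_pi.2 fun j => ?_))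
  · exact (continuousOn_pderivAt_joint hU i).comp hφ fun p hp => hp
  · exact continuousOn_finsetSum _ fun i _ => ContinuousOn.mul
      (Continuous.continuousOn (by fun_prop))
      ((continuousOn_pderivAt_pderivAt_joint hU i j).comp hφ fun p hp => hp)

/-- The derivative of `degeneracyMap`. -/
def degeneracyDeriv (I A J C : Finset (Fin 4)) (f : ParamSpace → ℝ) (z ζ : PointVec) :
    DegValue I A J C :=
  ((fun i => ζ.2 i, ∑ i, 2 * z.2 i * ζ.2 i, fun i => ζ.1 i),
    (fun i => ∑ k, ζ.1 k * pderivAt k (pderivAt i f) z.1,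
      fun j => ∑ i, (ζ.2 i * pderivAt j (pderivAt i f) z.1 +
        z.2 i * ∑ k, ζ.1 k * pderivAt k (pderivAt j (pderivAt i f)) z.1)))

theorem differentiableAt_degeneracyMap (hU : IsOpen U) (I A J C : Finset (Fin 4)) (c : ℝ)
    {f : ParamSpace → ℝ} (hf : ContDiffOn ℝ ∞ f U) {z : PointVec} (hz : z.1 ∈ U) :
    DifferentiableAt ℝ (degeneracyMap I A J C c f) z := by
  have h : ∀ g : ParamSpace → ℝ, ContDiffOn ℝ ∞ g U →
      DifferentiableAt ℝ (fun z : PointVec => g z.1) z := fun g hg =>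
    (hg.differentiableAt_of_isOpen hU hz).comp z differentiableAt_fst
  refine DifferentiableAt.prodMk (by fun_prop) (DifferentiableAt.prodMk
    (differentiableAt_pi.2 fun i => h _ (contDiffOn_pderivAt hU hf i))
    (differentiableAt_pi.2 fun j => DifferentiableAt.fun_sum fun i _ =>
      DifferentiableAt.mul (by fun_prop)
        (h _ (contDiffOn_pderivAt hU (contDiffOn_pderivAt hU hf i) j))))

/-- The explicit formula involves partial derivatives of order at most three, so the derivative
depends continuously on the Hamiltonian and the point jointly, as needed for openness. -/
theorem fderiv_degeneracyMap (hU : IsOpen U) (I A J C : Finset (Fin 4)) (c : ℝ)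
    {f : ParamSpace → ℝ} (hf : ContDiffOn ℝ ∞ f U) {z : PointVec} (hz : z.1 ∈ U) (ζ : PointVec) :
    fderiv ℝ (degeneracyMap I A J C c f) z ζ = degeneracyDeriv I A J C f z ζ := by
  have hline : HasDerivAt (fun t : ℝ => degeneracyMap I A J C c f (z + t • ζ))
      (fderiv ℝ (degeneracyMap I A J C c f) z ζ) 0 := by
    have h1 : HasDerivAt (fun t : ℝ => z + t • ζ) ζ 0 := by
      simpa using ((hasDerivAt_id (0 : ℝ)).smul_const ζ).const_add z
    have h2 : HasFDerivAt (degeneracyMap I A J C c f) (fderiv ℝ (degeneracyMap I A J C c f) z)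
        (z + (0 : ℝ) • ζ) := by
      simpa using (differentiableAt_degeneracyMap hU I A J C c hf hz).hasFDerivAt
    exact h2.comp_hasDerivAt (0 : ℝ) h1
  have hlin : ∀ x y : ℝ, HasDerivAt (fun t : ℝ => x + t * y) y 0 := fun x y => by
    simpa using ((hasDerivAt_id (0 : ℝ)).mul_const y).const_add x
  have hg : ∀ g : ParamSpace → ℝ, ContDiffOn ℝ ∞ g U →
      HasDerivAt (fun t : ℝ => g (z.1 + t • ζ.1)) (∑ k, ζ.1 k * pderivAt k g z.1) 0 := by
    intro g hg
    have h1 : HasDerivAt (fun t : ℝ => z.1 + t • ζ.1) ζ.1 0 := by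
      simpa using ((hasDerivAt_id (0 : ℝ)).smul_const ζ.1).const_add z.1
    have h2 : HasFDerivAt g (fderiv ℝ g z.1) (z.1 + (0 : ℝ) • ζ.1) := by
      simpa using (hg.differentiableAt_of_isOpen hU hz).hasFDerivAt
    rw [← fderiv_apply_eq_sum]
    exact h2.comp_hasDerivAt (0 : ℝ) h1
  refine hline.unique (HasDerivAt.prodMk (HasDerivAt.prodMk (hasDerivAt_pi.2 fun i => hlin _ _)
    (HasDerivAt.prodMk ?_ (hasDerivAt_pi.2 fun i => (hlin _ _).sub_const c)))
    (HasDerivAt.prodMk (hasDerivAt_pi.2 fun i => hg _ (contDiffOn_pderivAt hU hf i))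
      (hasDerivAt_pi.2 fun j => HasDerivAt.fun_sum fun i _ => ?_)))
  · refine HasDerivAt.sub_const _ (HasDerivAt.fun_sum fun i _ => ?_)
    simpa using (hlin (z.2 i) (ζ.2 i)).fun_pow 2
  · simpa using (hlin (z.2 i) (ζ.2 i)).fun_mul
      (hg _ (contDiffOn_pderivAt hU (contDiffOn_pderivAt hU hf i) j))

theorem continuousOn_degeneracyDeriv (hU : IsOpen U) (I A J C : Finset (Fin 4)) :
    ContinuousOn (fun p : IntegrableHam U × (PointVec × PointVec) =>
      degeneracyDeriv I A J C p.1.1 p.2.1 p.2.2) {p | p.2.1.1 ∈ U} := by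
  have hφ : ContinuousOn (fun p : IntegrableHam U × (PointVec × PointVec) => (p.1, p.2.1.1))
      {p | p.2.1.1 ∈ U} := Continuous.continuousOn (by fun_prop)
  have h2 : ∀ i j, ContinuousOn (fun p : IntegrableHam U × (PointVec × PointVec) =>
      pderivAt j (pderivAt i p.1.1) p.2.1.1) {p | p.2.1.1 ∈ U} := fun i j =>
    (continuousOn_pderivAt_pderivAt_joint hU i j).comp hφ fun p hp => hp
  have h3 : ∀ i j k, ContinuousOn (fun p : IntegrableHam U × (PointVec × PointVec) =>
      pderivAt k (pderivAt j (pderivAt i p.1.1)) p.2.1.1) {p | p.2.1.1 ∈ U} := fun i j k =>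
    (continuousOn_iterPderiv hU [k, j, i]).comp hφ fun p hp => hp
  refine ContinuousOn.prodMk (Continuous.continuousOn (by fun_prop)) (ContinuousOn.prodMk
    (continuousOn_pi.2 fun i => ?_) (continuousOn_pi.2 fun j => ?_))
  · exact continuousOn_finsetSum _ fun k _ => ContinuousOn.mul
      (Continuous.continuousOn (by fun_prop)) (h2 _ _)
  · exact continuousOn_finsetSum _ fun i _ => ContinuousOn.add (ContinuousOn.mul
      (Continuous.continuousOn (by fun_prop)) (h2 _ _)) (ContinuousOn.mul
      (Continuous.continuousOn (by fun_prop)) (continuousOn_finsetSum _ fun k _ =>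
        ContinuousOn.mul (Continuous.continuousOn (by fun_prop)) (h3 _ _ _)))

/-- This is the tube lemma for the open condition of being nonzero. -/
theorem isOpen_forall_ne_zero {X Y V : Type*} [TopologicalSpace X] [TopologicalSpace Y]
    [TopologicalSpace V] [T1Space V] [Zero V] {Φ : X × Y → V} {O S : Set Y} (hO : IsOpen O)
    (hΦ : ContinuousOn Φ {p | p.2 ∈ O}) (hS : IsCompact S) (hSO : S ⊆ O) :
    IsOpen {x | ∀ y ∈ S, Φ (x, y) ≠ 0} := by
  rw [isOpen_iff_mem_nhds]
  intro x hx
  refine hS.eventually_forall_of_forall_eventually (P := fun x y => Φ (x, y) ≠ 0) fun y hy => ?_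
  have hO' : IsOpen {p : X × Y | p.2 ∈ O} := hO.preimage continuous_snd
  exact (hΦ.continuousAt (hO'.mem_nhds (hSO hy))).eventually_ne (hx y hy)

/-- The degeneracy does not occur over the set `S`. -/
def HasNoDegeneracy (I A J C : Finset (Fin 4)) (c : ℝ) (S : Set ParamSpace)
    (f : ParamSpace → ℝ) : Prop :=
  ∀ z : PointVec, z.1 ∈ S → degeneracyMap I A J C c f z ≠ 0

/-- The degeneracy occurs at regular zeros only over the set `S`. -/
def HasRegularDegeneracy (I A J C : Finset (Fin 4)) (c : ℝ) (S : Set ParamSpace)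
    (f : ParamSpace → ℝ) : Prop :=
  ∀ z : PointVec, z.1 ∈ S → degeneracyMap I A J C c f z = 0 →
    ∀ ζ, fderiv ℝ (degeneracyMap I A J C c f) z ζ = 0 → ζ = 0

theorem mem_closedBall_of_degeneracyMap_eq_zero {I A J C : Finset (Fin 4)} {c : ℝ}
    {f : ParamSpace → ℝ} {z : PointVec} (h : degeneracyMap I A J C c f z = 0) :
    z.2 ∈ Metric.closedBall (0 : Fin 4 → ℝ) 1 := by
  have hw := (degeneracyMap_eq_zero_iff.1 h).2.1
  rw [mem_closedBall_zero_iff, pi_norm_le_iff_of_nonneg zero_le_one]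
  intro i
  have : z.2 i ^ 2 ≤ ∑ i, z.2 i ^ 2 :=
    Finset.single_le_sum (f := fun i => z.2 i ^ 2) (fun i _ => sq_nonneg _) (Finset.mem_univ i)
  rw [Real.norm_eq_abs, abs_le_one_iff_mul_self_le_one]
  nlinarith

theorem isOpen_hasNoDegeneracy (hU : IsOpen U) (I A J C : Finset (Fin 4)) (c : ℝ)
    {K : Set ParamSpace} (hK : IsCompact K) (hKU : K ⊆ U) :
    IsOpen {H : IntegrableHam U | HasNoDegeneracy I A J C c K H.1} := by
  have h := isOpen_forall_ne_zero (hU.prod (isOpen_univ (X := Fin 4 → ℝ)))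
    ((continuousOn_degeneracyMap hU I A J C c).mono fun p hp => hp.1)
    (hK.prod (isCompact_closedBall (0 : Fin 4 → ℝ) 1)) (Set.prod_mono hKU (Set.subset_univ _))
  convert h using 1
  ext H
  exact ⟨fun hH z hz => hH z hz.1,
    fun hH z hz h0 => hH z ⟨hz, mem_closedBall_of_degeneracyMap_eq_zero h0⟩ h0⟩

theorem isOpen_hasRegularDegeneracy (hU : IsOpen U) (I A J C : Finset (Fin 4)) (c : ℝ)
    {K : Set ParamSpace} (hK : IsCompact K) (hKU : K ⊆ U) :
    IsOpen {H : IntegrableHam U | HasRegularDegeneracy I A J C c K H.1} := by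
  have hφ : ContinuousOn (fun p : IntegrableHam U × (PointVec × PointVec) => (p.1, p.2.1))
      {p | p.2.1.1 ∈ U} := Continuous.continuousOn (by fun_prop)
  have h := isOpen_forall_ne_zero
    ((hU.prod (isOpen_univ (X := Fin 4 → ℝ))).prod (isOpen_univ (X := PointVec)))
    ((((continuousOn_degeneracyMap hU I A J C c).comp hφ fun p hp => hp).prodMk
      (continuousOn_degeneracyDeriv hU I A J C)).mono fun p hp => hp.1.1)
    ((hK.prod (isCompact_closedBall (0 : Fin 4 → ℝ) 1)).prod (isCompact_sphere (0 : PointVec) 1))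
    (Set.prod_mono (Set.prod_mono hKU (Set.subset_univ _)) (Set.subset_univ _))
  convert h using 1
  ext H
  constructor
  · rintro hH ⟨z, ζ⟩ ⟨⟨hz, -⟩, hζ⟩ h0
    rw [Prod.mk_eq_zero] at h0
    rw [hH z hz h0.1 ζ (by rw [fderiv_degeneracyMap hU I A J C c H.2 (hKU hz)]; exact h0.2)] at hζ
    simp at hζ
  · intro hH z hz h0 ζ hζ
    by_contra hne
    have hn : ‖ζ‖ ≠ 0 := norm_ne_zero_iff.2 hne
    -- By linearity a kernel vector may be taken on the unit sphere, which makes regularity a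
    -- nonvanishing condition over a compact set.
    refine hH (z, ‖ζ‖⁻¹ • ζ) ⟨⟨hz, mem_closedBall_of_degeneracyMap_eq_zero h0⟩, ?_⟩ ?_
    · simp [norm_smul, hn]
    · refine Prod.mk_eq_zero.2 ⟨h0, ?_⟩
      change degeneracyDeriv I A J C H.1 z (‖ζ‖⁻¹ • ζ) = 0
      rw [← fderiv_degeneracyMap hU I A J C c H.2 (hKU hz), map_smul, hζ, smul_zero]

/-- The Hamiltonians without the degeneracies of excessive codimension. -/
structure IsNondegenerate (U : Set ParamSpace) (c₀ : ℝ) (f : ParamSpace → ℝ) : Prop where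
  regularT : HasNoDegeneracy {2} {2} Finset.univ ∅ 0 U f
  regularF : HasNoDegeneracy {0, 1} {0, 1} Finset.univ ∅ 0 U f
  regularR : HasNoDegeneracy {0, 1, 2} {0, 1, 2} Finset.univ ∅ 0 U f
  regularLevel : HasNoDegeneracy {0, 1, 2} {0, 1, 2} {0, 1, 2} {3} c₀ U f
  normalLevel : HasNoDegeneracy {0, 1} {0, 1, 2} {0, 1} {3} c₀ U f
  normal : HasRegularDegeneracy {0, 1} {0, 1, 2} {0, 1} ∅ 0 U f

theorem dense_isNondegenerate (hU : IsOpen U) (c₀ : ℝ) :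
    Dense {H : IntegrableHam U | IsNondegenerate U c₀ H.1} := by
  intro H
  have h : ∀ᵐ a ∂(Measure.addHaar : Measure QuadCoeff),
      IsNondegenerate U c₀ (H.addQuad a).1 := by
    -- The numbers of equations, in the order complement of `I`, length, `C`, `A`, `J`, are
    -- 3+1+0+1+4, 2+1+0+2+4, 1+1+0+3+4, 1+1+1+3+3 and 2+1+1+3+2, each nine against eight unknowns.
    -- The last system has 2+1+0+3+2, exactly eight.
    filter_upwards [ae_degeneracyMap_ne_zero hU {2} {2} Finset.univ ∅ 0 H (by decide),
      ae_degeneracyMap_ne_zero hU {0, 1} {0, 1} Finset.univ ∅ 0 H (by decide),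
      ae_degeneracyMap_ne_zero hU {0, 1, 2} {0, 1, 2} Finset.univ ∅ 0 H (by decide),
      ae_degeneracyMap_ne_zero hU {0, 1, 2} {0, 1, 2} {0, 1, 2} {3} c₀ H (by decide),
      ae_degeneracyMap_ne_zero hU {0, 1} {0, 1, 2} {0, 1} {3} c₀ H (by decide),
      ae_degeneracyMap_regular hU {0, 1} {0, 1, 2} {0, 1} ∅ 0 H (by decide)]
      with a h1 h2 h3 h4 h5 h6
    exact ⟨h1, h2, h3, h4, h5, h6⟩
  -- A set of full measure is dense, so good coefficients occur arbitrarily close to zero.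
  refine mem_closure_of_frequently_of_tendsto ?_ (H.tendsto_addQuad hU)
  exact mem_closure_iff_frequently.1 ((Measure.dense_of_ae h) 0)

theorem mem_residual_of_dense_of_forall_isOpen {X : Type*} [TopologicalSpace X] {G : Set X}
    (hG : Dense G) {t : ℕ → Set X} (ht : ∀ n, IsOpen (t n)) (hGt : ∀ n, G ⊆ t n) :
    ⋂ n, t n ∈ residual X :=
  countable_iInter_mem.2 fun n => residual_of_dense_open (ht n) (hG.mono (hGt n))

/-- Over each compact piece of `U` the conditions define open sets, dense because they contain the
dense set of nondegenerate Hamiltonians. Density is established independently, so no Baire property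
of the function space is needed. -/
theorem residual_isNondegenerate (hU : IsOpen U) (c₀ : ℝ) :
    {H : IntegrableHam U | IsNondegenerate U c₀ H.1} ∈ residual (IntegrableHam U) := by
  have hG := dense_isNondegenerate hU c₀
  obtain ⟨K, hK, hKU⟩ : IsSigmaCompact U := by
    have : SigmaCompactSpace U :=
      have := hU.locallyCompactSpace
      inferInstance
    exact isSigmaCompact_iff_sigmaCompactSpace.2 this
  have hsub : ∀ n, K n ⊆ U := fun n => hKU ▸ Set.subset_iUnion K n
  have hno : ∀ (I A J C : Finset (Fin 4)) (c : ℝ),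
      (∀ H : IntegrableHam U, IsNondegenerate U c₀ H.1 → HasNoDegeneracy I A J C c U H.1) →
      {H : IntegrableHam U | HasNoDegeneracy I A J C c U H.1} ∈ residual (IntegrableHam U) := by
    intro I A J C c h
    refine mem_of_superset (mem_residual_of_dense_of_forall_isOpen hG
      (fun n => isOpen_hasNoDegeneracy hU I A J C c (hK n) (hsub n))
      fun n H hH z hz => h H hH z (hsub n hz)) fun H hH z hz => ?_
    rw [← hKU] at hz
    obtain ⟨n, hn⟩ := Set.mem_iUnion.1 hz
    exact Set.mem_iInter.1 hH n z hn
  have hreg : {H : IntegrableHam U | HasRegularDegeneracy {0, 1} {0, 1, 2} {0, 1} ∅ 0 U H.1} ∈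
      residual (IntegrableHam U) := by
    refine mem_of_superset (mem_residual_of_dense_of_forall_isOpen hG
      (fun n => isOpen_hasRegularDegeneracy hU {0, 1} {0, 1, 2} {0, 1} ∅ 0 (hK n) (hsub n))
      fun n H hH z hz => hH.normal z (hsub n hz)) fun H hH z hz => ?_
    rw [← hKU] at hz
    obtain ⟨n, hn⟩ := Set.mem_iUnion.1 hz
    exact Set.mem_iInter.1 hH n z hn
  filter_upwards [hno _ _ _ _ _ fun H h => h.regularT, hno _ _ _ _ _ fun H h => h.regularF,
    hno _ _ _ _ _ fun H h => h.regularR, hno _ _ _ _ _ fun H h => h.regularLevel,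
    hno _ _ _ _ _ fun H h => h.normalLevel, hreg] with H h1 h2 h3 h4 h5 h6
  exact ⟨h1, h2, h3, h4, h5, h6⟩

/-! ### The normal linearization -/

theorem joinParam_add_single (y : Base) (c s : ℝ) (i : Fin 3) :
    joinParam (y + s • EuclideanSpace.single i 1) c =
      joinParam y c + s • EuclideanSpace.single (Fin.castSucc i) 1 := by
  ext k
  fin_cases i <;> fin_cases k <;> simp [joinParam]

theorem hasDerivAt_line {f : ParamSpace → ℝ} {q : ParamSpace} (hf : DifferentiableAt ℝ f q)
    (ξ : ParamSpace) : HasDerivAt (fun s : ℝ => f (q + s • ξ)) (fderiv ℝ f q ξ) 0 := by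
  have h1 : HasDerivAt (fun t : ℝ => q + t • ξ) ξ 0 := by
    simpa using ((hasDerivAt_id (0 : ℝ)).smul_const ξ).const_add q
  have h2 : HasFDerivAt f (fderiv ℝ f q) (q + (0 : ℝ) • ξ) := by
    simpa using hf.hasFDerivAt
  exact h2.comp_hasDerivAt (0 : ℝ) h1

theorem deriv_joinParam {f : ParamSpace → ℝ} {y : Base} {c : ℝ}
    (hf : DifferentiableAt ℝ f (joinParam y c)) (i : Fin 3) :
    deriv (fun s : ℝ => f (joinParam (y + s • EuclideanSpace.single i 1) c)) 0 =
      pderivAt (Fin.castSucc i) f (joinParam y c) := by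
  simp_rw [joinParam_add_single]
  exact (hasDerivAt_line hf _).deriv

theorem hamiltonianField_phaseHamiltonian {f : ParamSpace → ℝ} {y : Base} {c : ℝ}
    (hf : DifferentiableAt ℝ f (joinParam y c)) (θ : Angle2Pi) :
    hamiltonianField (phaseHamiltonian f c) (y, θ) =
      ![pderivAt 1 f (joinParam y c), -pderivAt 0 f (joinParam y c), 0,
        pderivAt 2 f (joinParam y c)] := by
  simp only [hamiltonianField, phaseHamiltonian, deriv_joinParam hf, deriv_const, neg_zero]
  rfl

theorem isFixedCircle_iff {f : ParamSpace → ℝ} {y : Base} {c : ℝ}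
    (hf : DifferentiableAt ℝ f (joinParam y c)) :
    IsFixedCircle (phaseHamiltonian f c) y ↔ pderivAt 0 f (joinParam y c) = 0 ∧
      pderivAt 1 f (joinParam y c) = 0 ∧ pderivAt 2 f (joinParam y c) = 0 := by
  simp only [IsFixedCircle, hamiltonianField_phaseHamiltonian hf]
  constructor
  · intro h
    have h := h 0
    have h0 := congrFun h 0
    have h1 := congrFun h 1
    have h2 := congrFun h 3
    simp at h0 h1 h2
    exact ⟨h1, h0, h2⟩
  · rintro ⟨h0, h1, h2⟩ θ
    rw [h0, h1, h2]
    ext i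
    fin_cases i <;> simp

theorem isFixedCircle_iff_mem_curveR (hU : IsOpen U) {f : ParamSpace → ℝ}
    (hf : ContDiffOn ℝ ∞ f U) {y : Base} {c : ℝ} (hy : joinParam y c ∈ U) :
    IsFixedCircle (phaseHamiltonian f c) y ↔ joinParam y c ∈ curveR U f := by
  rw [isFixedCircle_iff (hf.differentiableAt_of_isOpen hU hy)]
  simp only [curveR, surfaceF, surfaceT, Set.mem_inter_iff, Set.mem_ofPred_eq]
  tauto

theorem continuous_joinParam : Continuous fun p : Base × ℝ => joinParam p.1 p.2 := by
  refine (PiLp.continuous_toLp 2 _).comp (continuous_pi fun i => ?_)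
  fin_cases i <;> simp <;> fun_prop

theorem normalLinearization_phaseHamiltonian (hU : IsOpen U) {f : ParamSpace → ℝ}
    (hf : ContDiffOn ℝ ∞ f U) {y : Base} {c : ℝ} (hy : joinParam y c ∈ U) (θ : Angle2Pi) :
    normalLinearization (phaseHamiltonian f c) (y, θ) =
      !![pderivAt 0 (pderivAt 1 f) (joinParam y c), pderivAt 1 (pderivAt 1 f) (joinParam y c);
        -pderivAt 0 (pderivAt 0 f) (joinParam y c), -pderivAt 1 (pderivAt 0 f) (joinParam y c)] := by
  have hev : ∀ i : Fin 3, ∀ᶠ s : ℝ in 𝓝 0,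
      joinParam (y + s • EuclideanSpace.single i 1) c ∈ U := by
    intro i
    have hc : Continuous fun s : ℝ => joinParam (y + s • EuclideanSpace.single i 1) c :=
      continuous_joinParam.comp (f := fun s : ℝ => (y + s • EuclideanSpace.single i 1, c))
        (by fun_prop)
    refine hc.continuousAt.eventually_mem (hU.mem_nhds ?_)
    simpa using hy
  have key : ∀ (j : Fin 3) (i : Fin 4), deriv (fun s : ℝ => hamiltonianField (phaseHamiltonian f c)
      (y + s • EuclideanSpace.single j 1, θ) i) 0 = deriv (fun s : ℝ =>
        (![pderivAt 1 f (joinParam (y + s • EuclideanSpace.single j 1) c),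
          -pderivAt 0 f (joinParam (y + s • EuclideanSpace.single j 1) c), 0,
          pderivAt 2 f (joinParam (y + s • EuclideanSpace.single j 1) c)] : Fin 4 → ℝ) i) 0 := by
    intro j i
    refine EventuallyEq.deriv_eq ?_
    filter_upwards [hev j] with s hs
    rw [hamiltonianField_phaseHamiltonian (hf.differentiableAt_of_isOpen hU hs)]
  have hd : ∀ (i : Fin 4) (j : Fin 3), deriv (fun s : ℝ =>
      pderivAt i f (joinParam (y + s • EuclideanSpace.single j 1) c)) 0 =
      pderivAt (Fin.castSucc j) (pderivAt i f) (joinParam y c) := fun i j =>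
    deriv_joinParam ((contDiffOn_pderivAt hU hf i).differentiableAt_of_isOpen hU hy) j
  ext i j
  simp only [normalLinearization, Matrix.of_apply]
  rw [key]
  fin_cases i
  · fin_cases j
    · exact hd 1 0
    · exact hd 1 1
  · fin_cases j
    · exact (deriv.fun_neg).trans (congrArg Neg.neg (hd 0 0))
    · exact (deriv.fun_neg).trans (congrArg Neg.neg (hd 0 1))

/-- The determinant of the normal linearization. -/
def normalDet (f : ParamSpace → ℝ) (q : ParamSpace) : ℝ :=
  pderivAt 0 (pderivAt 0 f) q * pderivAt 1 (pderivAt 1 f) q - pderivAt 1 (pderivAt 0 f) q ^ 2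

/-- By symmetry of second derivatives the matrix has trace zero, so only the determinant remains in
the characteristic polynomial. -/
theorem mem_spectrum_normalLinearization_iff (hU : IsOpen U) {f : ParamSpace → ℝ}
    (hf : ContDiffOn ℝ ∞ f U) {y : Base} {c : ℝ} (hy : joinParam y c ∈ U) (θ : Angle2Pi) (μ : ℂ) :
    μ ∈ spectrum ℂ ((normalLinearization (phaseHamiltonian f c) (y, θ)).map
      (Complex.ofReal : ℝ → ℂ)) ↔ μ ^ 2 = -(normalDet f (joinParam y c) : ℂ) := by
  rw [spectrum.mem_iff, Matrix.isUnit_iff_isUnit_det, isUnit_iff_ne_zero, not_not,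
    normalLinearization_phaseHamiltonian hU hf hy, Matrix.det_fin_two,
    pderivAt_comm hU hf hy 0 1, ← sub_eq_zero (b := -(normalDet f (joinParam y c) : ℂ))]
  simp only [Matrix.sub_apply, Matrix.algebraMap_matrix_apply, Matrix.map_apply, Matrix.of_apply,
    Matrix.cons_val', Matrix.cons_val_zero, Matrix.cons_val_one, normalDet]
  norm_num
  ring_nf

theorem isHyperbolicCircle_iff (hU : IsOpen U) {f : ParamSpace → ℝ}
    (hf : ContDiffOn ℝ ∞ f U) {y : Base} {c : ℝ} (hy : joinParam y c ∈ U) :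
    IsHyperbolicCircle (phaseHamiltonian f c) y ↔
      joinParam y c ∈ curveR U f ∧ normalDet f (joinParam y c) < 0 := by
  simp only [IsHyperbolicCircle, isFixedCircle_iff_mem_curveR hU hf hy,
    mem_spectrum_normalLinearization_iff hU hf hy, forall_const]
  refine and_congr_right fun _ => ⟨fun h => ?_, fun h μ hμ h0 => ?_⟩
  · by_contra! hd
    refine h (Complex.I * (√(normalDet f (joinParam y c)) : ℂ)) ?_ (by simp)
    rw [mul_pow, Complex.I_sq, ← Complex.ofReal_pow, Real.sq_sqrt hd]
    ring
  · have := congrArg Complex.re hμ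
    simp [pow_two, h0] at this
    nlinarith

theorem isEllipticCircle_iff (hU : IsOpen U) {f : ParamSpace → ℝ}
    (hf : ContDiffOn ℝ ∞ f U) {y : Base} {c : ℝ} (hy : joinParam y c ∈ U) :
    IsEllipticCircle (phaseHamiltonian f c) y ↔
      joinParam y c ∈ curveR U f ∧ 0 < normalDet f (joinParam y c) := by
  simp only [IsEllipticCircle, isFixedCircle_iff_mem_curveR hU hf hy,
    mem_spectrum_normalLinearization_iff hU hf hy, forall_const]
  refine and_congr_right fun _ => ⟨fun h => ?_, fun h μ hμ => ⟨?_, ?_⟩⟩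
  · by_contra! hd
    -- For a nonpositive determinant this real number is an eigenvalue; ellipticity would make it
    -- both zero and nonzero.
    have hs := h (√(-normalDet f (joinParam y c)) : ℂ) (by
      rw [← Complex.ofReal_pow, Real.sq_sqrt (by linarith)]
      simp)
    exact hs.2 (Complex.ext hs.1 (by simp))
  · have h1 := congrArg Complex.re hμ
    have h2 := congrArg Complex.im hμ
    simp [pow_two] at h1 h2
    by_contra h0
    have : μ.im = 0 := by
      rcases mul_eq_zero.1 (show μ.re * μ.im = 0 by linarith) with h3 | h3
      · exact absurd h3 h0
      · exact h3
    rw [this] at h1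
    nlinarith [sq_nonneg μ.re]
  · rintro rfl
    have h1 := congrArg Complex.re hμ
    simp at h1
    exact h.ne' h1

/-! ### Transversality in terms of differentials -/

/-- A proper image of the joint map would lie in the kernel of a nonzero functional, whose
coefficients form a linear relation. -/
theorem exists_forall_apply_eq {n : ℕ} (L : Fin n → ParamSpace →L[ℝ] ℝ)
    (h : ∀ w : Fin n → ℝ, (∀ ξ, ∑ i, w i * L i ξ = 0) → w = 0) (r : Fin n → ℝ) :
    ∃ ξ, ∀ i, L i ξ = r i := by
  let Λ : ParamSpace →ₗ[ℝ] Fin n → ℝ := LinearMap.pi fun i => (L i).toLinearMap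
  have hsurj : Function.Surjective Λ := by
    by_contra hns
    obtain ⟨φ, hφ, hle⟩ := Submodule.exists_le_ker_of_lt_top (LinearMap.range Λ)
      (lt_top_iff_ne_top.2 fun ht => hns (LinearMap.range_eq_top.1 ht))
    have hsum : ∀ x : Fin n → ℝ, φ x = ∑ i, x i * φ (Pi.single i 1) := by
      intro x
      rw [LinearMap.pi_apply_eq_sum_univ φ x]
      simp only [smul_eq_mul]
      refine Finset.sum_congr rfl fun i _ => ?_
      congr 2
      ext j
      simp [Pi.single_apply, eq_comm]
    have h0 := h (fun i => φ (Pi.single i 1)) fun ξ => by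
      have := hle (LinearMap.mem_range_self Λ ξ)
      rw [LinearMap.mem_ker, hsum] at this
      simpa [Λ, mul_comm] using this
    apply hφ
    ext x
    rw [LinearMap.comp_apply, hsum]
    simp [fun i => congrFun h0 i]
  obtain ⟨ξ, hξ⟩ := hsurj r
  exact ⟨ξ, fun i => congrFun hξ i⟩

theorem eq_zero_of_forall_apply_eq_zero (L : Fin 4 → ParamSpace →L[ℝ] ℝ)
    (h : ∀ r : Fin 4 → ℝ, ∃ ξ, ∀ i, L i ξ = r i) {ξ : ParamSpace} (hξ : ∀ i, L i ξ = 0) :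
    ξ = 0 := by
  let Λ : ParamSpace →ₗ[ℝ] Fin 4 → ℝ := LinearMap.pi fun i => (L i).toLinearMap
  have hinj : Function.Injective Λ :=
    (LinearMap.injective_iff_surjective_of_finrank_eq_finrank (by simp)).2 fun r =>
      (h r).imp fun ξ hξ => funext hξ
  exact hinj ((funext hξ).trans (map_zero Λ).symm)

theorem exists_forall_apply_eq_of_forall_eq_zero (L : Fin 4 → ParamSpace →L[ℝ] ℝ)
    (h : ∀ ξ, (∀ i, L i ξ = 0) → ξ = 0) (r : Fin 4 → ℝ) : ∃ ξ, ∀ i, L i ξ = r i := by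
  let Λ : ParamSpace →ₗ[ℝ] Fin 4 → ℝ := LinearMap.pi fun i => (L i).toLinearMap
  have hsurj : Function.Surjective Λ :=
    (LinearMap.injective_iff_surjective_of_finrank_eq_finrank (by simp)).1
      ((injective_iff_map_eq_zero Λ).2 fun ξ hξ => h ξ fun i => congrFun hξ i)
  obtain ⟨ξ, hξ⟩ := hsurj r
  exact ⟨ξ, fun i => congrFun hξ i⟩

theorem transverseFT_of_exists {f : ParamSpace → ℝ} {q : ParamSpace}
    (h : ∀ r : Fin 3 → ℝ, ∃ ξ, fderiv ℝ (pderivAt 0 f) q ξ = r 0 ∧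
      fderiv ℝ (pderivAt 1 f) q ξ = r 1 ∧ fderiv ℝ (pderivAt 2 f) q ξ = r 2) :
    TransverseFT f q := by
  refine ⟨LinearIndependent.pair_iff.2 fun s t hst => ⟨?_, ?_⟩, fun h0 => ?_, ?_⟩
  · obtain ⟨ξ, h0, h1, -⟩ := h ![1, 0, 0]
    simpa [h0, h1] using congrArg (fun l : ParamSpace →L[ℝ] ℝ => l ξ) hst
  · obtain ⟨ξ, h0, h1, -⟩ := h ![0, 1, 0]
    simpa [h0, h1] using congrArg (fun l : ParamSpace →L[ℝ] ℝ => l ξ) hst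
  · obtain ⟨ξ, -, -, h2⟩ := h ![0, 0, 1]
    simp [h0] at h2
  · refine eq_top_iff.2 fun v _ => ?_
    obtain ⟨ξ, h0, h1, h2⟩ := h ![0, 0, fderiv ℝ (pderivAt 2 f) q v]
    refine Submodule.mem_sup.2 ⟨ξ, ⟨h0, h1⟩, v - ξ, ?_, by abel⟩
    change fderiv ℝ (pderivAt 2 f) q (v - ξ) = 0
    rw [map_sub, h2]
    simp

/-- The differentials of the equations of `R` and of the parameter. -/
def levelDifferentials (f : ParamSpace → ℝ) (q : ParamSpace) : Fin 4 → ParamSpace →L[ℝ] ℝ :=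
  ![fderiv ℝ (pderivAt 0 f) q, fderiv ℝ (pderivAt 1 f) q, fderiv ℝ (pderivAt 2 f) q,
    EuclideanSpace.proj 3]

/-- Both sides say that the differentials of `H_x`, `H_v`, `H_D` and `c` form a basis of the dual
space. -/
theorem transverseRC_iff {f : ParamSpace → ℝ} {q : ParamSpace} :
    TransverseRC f q ↔ ∀ ξ, (∀ i, levelDifferentials f q i ξ = 0) → ξ = 0 := by
  constructor
  · rintro ⟨⟨hF, hT, hFT⟩, hRC⟩ ξ hξ
    refine eq_zero_of_forall_apply_eq_zero _ (exists_forall_apply_eq _ fun w hw => ?_) hξ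
    -- In a linear relation `w`, a vector `η` tangent to `R` with `c`-component one forces `w 3 =
    -- 0`, then a vector `ν` tangent to `F` but not to `T` forces `w 2 = 0`, and regularity of `F`
    -- disposes of the rest.
    obtain ⟨η, hη, b, hb, hηb⟩ := Submodule.mem_sup.1
      (hRC.symm ▸ Submodule.mem_top : EuclideanSpace.single (3 : Fin 4) (1 : ℝ) ∈ _)
    have hη0 : fderiv ℝ (pderivAt 0 f) q η = 0 := hη.1.1
    have hη1 : fderiv ℝ (pderivAt 1 f) q η = 0 := hη.1.2
    have hη2 : fderiv ℝ (pderivAt 2 f) q η = 0 := hη.2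
    have hb3 : b 3 = 0 := hb
    have hη3 : η 3 = 1 := by
      have := congrArg (fun v : ParamSpace => v 3) hηb
      simpa [hb3] using this
    obtain ⟨u, hu⟩ : ∃ u, fderiv ℝ (pderivAt 2 f) q u ≠ 0 := by
      by_contra! h
      exact hT (ContinuousLinearMap.ext h)
    obtain ⟨ν, hν, b', hb', hνb⟩ := Submodule.mem_sup.1 (hFT.symm ▸ Submodule.mem_top : u ∈ _)
    have hν0 : fderiv ℝ (pderivAt 0 f) q ν = 0 := hν.1
    have hν1 : fderiv ℝ (pderivAt 1 f) q ν = 0 := hν.2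
    have hb'2 : fderiv ℝ (pderivAt 2 f) q b' = 0 := hb'
    have hν2 : fderiv ℝ (pderivAt 2 f) q ν ≠ 0 := by
      rw [← hνb, map_add, hb'2, add_zero] at hu
      exact hu
    have hsum : ∀ ξ : ParamSpace, w 0 * fderiv ℝ (pderivAt 0 f) q ξ +
        w 1 * fderiv ℝ (pderivAt 1 f) q ξ + w 2 * fderiv ℝ (pderivAt 2 f) q ξ + w 3 * ξ 3 = 0 := by
      intro ξ
      have := hw ξ
      rw [Fin.sum_univ_four] at this
      exact this
    have h3 : w 3 = 0 := by simpa [hη0, hη1, hη2, hη3] using hsum η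
    have h2 : w 2 = 0 := by simpa [hν0, hν1, hν2, h3] using hsum ν
    have h01 := LinearIndependent.pair_iff.1 hF (w 0) (w 1) (by
      ext ξ
      simpa [h2, h3] using hsum ξ)
    ext i
    fin_cases i
    · exact h01.1
    · exact h01.2
    · exact h2
    · exact h3
  · intro h
    have hs := exists_forall_apply_eq_of_forall_eq_zero _ h
    refine ⟨transverseFT_of_exists fun r => ?_, ?_⟩
    · obtain ⟨ξ, hξ⟩ := hs ![r 0, r 1, r 2, 0]
      exact ⟨ξ, hξ 0, hξ 1, hξ 2⟩
    · refine eq_top_iff.2 fun v _ => ?_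
      obtain ⟨ξ, hξ⟩ := hs ![0, 0, 0, v 3]
      refine Submodule.mem_sup.2 ⟨ξ, ⟨⟨hξ 0, hξ 1⟩, hξ 2⟩, v - ξ, ?_, by abel⟩
      have h3 : ξ 3 = v 3 := hξ 3
      change (v - ξ) 3 = 0
      simp [h3]

/-! ### Submanifolds given by independent equations -/

theorem sum_mul_apply_eq_zero_of_linearIndependent {n : ℕ} {L : Fin n → ParamSpace →L[ℝ] ℝ}
    (hL : LinearIndependent ℝ L) (w : Fin n → ℝ) (hw : ∀ ξ, ∑ i, w i * L i ξ = 0) : w = 0 := by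
  funext i
  refine Fintype.linearIndependent_iff.1 hL w ?_ i
  ext ξ
  simpa using hw ξ

theorem linearIndependent_of_sum_mul_apply_eq_zero {n : ℕ} {L : Fin n → ParamSpace →L[ℝ] ℝ}
    (h : ∀ w : Fin n → ℝ, (∀ ξ, ∑ i, w i * L i ξ = 0) → w = 0) : LinearIndependent ℝ L := by
  refine Fintype.linearIndependent_iff.2 fun w hw i => congrFun (h w fun ξ => ?_) i
  simpa using congrArg (fun l : ParamSpace →L[ℝ] ℝ => l ξ) hw

/-- The inverse function theorem makes the four functions a chart. Those of index at least `k` are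
the equations; the others only complete the coordinates. -/
theorem isEmbeddedSubmanifold_of_equations (hU : IsOpen U) {k : ℕ} {S : Set ParamSpace}
    (hSU : S ⊆ U) (h : ∀ q ∈ S, ∃ u : Fin 4 → ParamSpace → ℝ, (∀ i, ContDiffOn ℝ ∞ (u i) U) ∧
      LinearIndependent ℝ (fun i => fderiv ℝ (u i) q) ∧
      ∀ p ∈ U, p ∈ S ↔ ∀ i : Fin 4, k ≤ i.val → u i p = 0) :
    IsEmbeddedSubmanifold k S := by
  intro q hq
  obtain ⟨u, hu, hli, hS⟩ := h q hq
  let F : ParamSpace → ParamSpace := fun p => WithLp.toLp 2 fun i => u i p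
  have hF : ContDiffOn ℝ ∞ F U :=
    (PiLp.contDiff_toLp (p := 2)).comp_contDiffOn (contDiffOn_pi.2 hu)
  have hd : DifferentiableAt ℝ F q :=
    (hF.contDiffAt (hU.mem_nhds (hSU hq))).differentiableAt (by simp)
  have happ : ∀ ξ i, (fderiv ℝ F q ξ) i = fderiv ℝ (u i) q ξ := by
    intro ξ i
    have h1 := (EuclideanSpace.proj i : ParamSpace →L[ℝ] ℝ).hasFDerivAt.comp q hd.hasFDerivAt
    have h2 : fderiv ℝ (u i) q = _ := h1.fderiv
    rw [h2]
    rfl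
  have hinj : Function.Injective (fderiv ℝ F q) := by
    rw [injective_iff_map_eq_zero]
    intro ξ hξ
    refine eq_zero_of_forall_apply_eq_zero _ (exists_forall_apply_eq _
      (sum_mul_apply_eq_zero_of_linearIndependent hli)) fun i => ?_
    rw [← happ, hξ]
    rfl
  obtain ⟨e, hqe, heU, heF, hsymm, -⟩ :=
    exists_chart rfl (n := ∞) (by exact_mod_cast le_top) (by simp) hU hF (hSU hq) hinj
  refine ⟨e, hqe, ?_, hsymm, fun p hp => ?_⟩
  · rw [heF]
    exact hF.mono heU
  · rw [heF]
    exact hS p (heU hp)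

/-- It provides linear forms as complementary coordinates; they are prepended because the equations
occupy the last indices. -/
theorem exists_linearIndependent_cons {n : ℕ} {L : Fin n → ParamSpace →L[ℝ] ℝ}
    (hL : LinearIndependent ℝ L) (hn : n < 4) :
    ∃ x : ParamSpace →L[ℝ] ℝ, LinearIndependent ℝ (Fin.cons x L : Fin (n + 1) → _) := by
  refine exists_linearIndependent_cons_of_lt_finrank hL ?_
  have : Module.finrank ℝ (ParamSpace →L[ℝ] ℝ) = 4 := by
    rw [← (LinearMap.toContinuousLinearMap (𝕜 := ℝ) (E := ParamSpace) (F' := ℝ)).finrank_eq]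
    simp
  omega

theorem surfaceT_subset (f : ParamSpace → ℝ) : surfaceT U f ⊆ U := fun _ hq => hq.1

theorem surfaceF_subset (f : ParamSpace → ℝ) : surfaceF U f ⊆ U := fun _ hq => hq.1

theorem curveR_subset (f : ParamSpace → ℝ) : curveR U f ⊆ U := fun _ hq => hq.1.1

theorem isEmbeddedSubmanifold_surfaceT (hU : IsOpen U) {f : ParamSpace → ℝ}
    (hf : ContDiffOn ℝ ∞ f U) (h : ∀ q ∈ surfaceT U f, RegularT f q) :
    IsEmbeddedSubmanifold 3 (surfaceT U f) := by
  refine isEmbeddedSubmanifold_of_equations hU (surfaceT_subset f) fun q hq => ?_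
  have h1 : LinearIndependent ℝ ![fderiv ℝ (pderivAt 2 f) q] := by
    rw [linearIndependent_unique_iff]
    exact h q hq
  obtain ⟨x, hx⟩ := exists_linearIndependent_cons h1 (by norm_num)
  obtain ⟨y, hy⟩ := exists_linearIndependent_cons hx (by norm_num)
  obtain ⟨z, hz⟩ := exists_linearIndependent_cons hy (by norm_num)
  refine ⟨![z, y, x, pderivAt 2 f], fun i => ?_, ?_, fun p hp => ?_⟩
  · fin_cases i
    · exact z.contDiff.contDiffOn
    · exact y.contDiff.contDiffOn
    · exact x.contDiff.contDiffOn
    · exact contDiffOn_pderivAt hU hf 2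
  · convert hz using 1
    funext i
    fin_cases i
    · exact z.fderiv
    · exact y.fderiv
    · exact x.fderiv
    · rfl
  · simp [surfaceT, hp, Fin.forall_fin_succ]

theorem isEmbeddedSubmanifold_surfaceF (hU : IsOpen U) {f : ParamSpace → ℝ}
    (hf : ContDiffOn ℝ ∞ f U) (h : ∀ q ∈ surfaceF U f, RegularF f q) :
    IsEmbeddedSubmanifold 2 (surfaceF U f) := by
  refine isEmbeddedSubmanifold_of_equations hU (surfaceF_subset f) fun q hq => ?_
  obtain ⟨x, hx⟩ := exists_linearIndependent_cons (h q hq) (by norm_num)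
  obtain ⟨y, hy⟩ := exists_linearIndependent_cons hx (by norm_num)
  refine ⟨![y, x, pderivAt 0 f, pderivAt 1 f], fun i => ?_, ?_, fun p hp => ?_⟩
  · fin_cases i
    · exact y.contDiff.contDiffOn
    · exact x.contDiff.contDiffOn
    · exact contDiffOn_pderivAt hU hf 0
    · exact contDiffOn_pderivAt hU hf 1
  · convert hy using 1
    funext i
    fin_cases i
    · exact y.fderiv
    · exact x.fderiv
    · rfl
    · rfl
  · simp [surfaceF, hp, Fin.forall_fin_succ]

theorem isEmbeddedSubmanifold_curveR (hU : IsOpen U) {f : ParamSpace → ℝ}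
    (hf : ContDiffOn ℝ ∞ f U) (h : ∀ q ∈ curveR U f, LinearIndependent ℝ
      ![fderiv ℝ (pderivAt 0 f) q, fderiv ℝ (pderivAt 1 f) q, fderiv ℝ (pderivAt 2 f) q]) :
    IsEmbeddedSubmanifold 1 (curveR U f) := by
  refine isEmbeddedSubmanifold_of_equations hU (curveR_subset f) fun q hq => ?_
  obtain ⟨x, hx⟩ := exists_linearIndependent_cons (h q hq) (by norm_num)
  refine ⟨![x, pderivAt 0 f, pderivAt 1 f, pderivAt 2 f], fun i => ?_, ?_, fun p hp => ?_⟩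
  · fin_cases i
    · exact x.contDiff.contDiffOn
    · exact contDiffOn_pderivAt hU hf 0
    · exact contDiffOn_pderivAt hU hf 1
    · exact contDiffOn_pderivAt hU hf 2
  · convert hx using 1
    funext i
    fin_cases i
    · exact x.fderiv
    · rfl
    · rfl
    · rfl
  · simp [curveR, surfaceF, surfaceT, hp, Fin.forall_fin_succ, and_assoc]

/-! ### Consequences of nondegeneracy -/

theorem exists_degeneracyMap_eq_zero {I A J C : Finset (Fin 4)} {c : ℝ} {f : ParamSpace → ℝ}
    {q : ParamSpace} (hC : ∀ i ∈ C, q i = c) (hA : ∀ i ∈ A, pderivAt i f q = 0)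
    {w : Fin 4 → ℝ} (hI : ∀ i ∉ I, w i = 0)
    (hJ : ∀ j ∈ J, ∑ i, w i * pderivAt j (pderivAt i f) q = 0) (hw : w ≠ 0) :
    ∃ w', degeneracyMap I A J C c f (q, w') = 0 := by
  have hpos : 0 < ∑ i, w i ^ 2 := by
    obtain ⟨i, hi⟩ := Function.ne_iff.1 hw
    exact Finset.sum_pos' (fun i _ => sq_nonneg _) ⟨i, Finset.mem_univ i, by
      have : w i ≠ 0 := hi
      positivity⟩
  refine ⟨fun i => w i / √(∑ i, w i ^ 2), degeneracyMap_eq_zero_iff.2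
    ⟨fun i hi => by simp [hI i hi], ?_, hC, hA, fun j hj => ?_⟩⟩
  · simp_rw [div_pow, Real.sq_sqrt hpos.le]
    rw [← Finset.sum_div, div_self hpos.ne']
  · simp_rw [div_mul_eq_mul_div]
    rw [← Finset.sum_div, hJ j hj, zero_div]

theorem HasNoDegeneracy.eq_zero {I A J C : Finset (Fin 4)} {c : ℝ} {f : ParamSpace → ℝ}
    (h : HasNoDegeneracy I A J C c U f) {q : ParamSpace} (hq : q ∈ U) (hC : ∀ i ∈ C, q i = c)
    (hA : ∀ i ∈ A, pderivAt i f q = 0) {w : Fin 4 → ℝ} (hI : ∀ i ∉ I, w i = 0)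
    (hJ : ∀ j ∈ J, ∑ i, w i * pderivAt j (pderivAt i f) q = 0) : w = 0 := by
  by_contra hw
  obtain ⟨w', hw'⟩ := exists_degeneracyMap_eq_zero hC hA hI hJ hw
  exact h (q, w') hq hw'

theorem exists_null_vector (hU : IsOpen U) {f : ParamSpace → ℝ} (hf : ContDiffOn ℝ ∞ f U)
    {q : ParamSpace} (hq : q ∈ U) (h : normalDet f q = 0) : ∃ w : Fin 4 → ℝ, w ≠ 0 ∧
      (∀ i ∉ ({0, 1} : Finset (Fin 4)), w i = 0) ∧
      ∀ j ∈ ({0, 1} : Finset (Fin 4)), ∑ i, w i * pderivAt j (pderivAt i f) q = 0 := by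
  have hcomm := pderivAt_comm hU hf hq 0 1
  unfold normalDet at h
  by_cases h0 : pderivAt 0 (pderivAt 0 f) q = 0 ∧ pderivAt 1 (pderivAt 0 f) q = 0
  · refine ⟨![1, 0, 0, 0], fun hw => by simpa using congrFun hw 0, ?_, ?_⟩
    · intro i hi
      fin_cases i <;> simp_all
    · intro j hj
      fin_cases j <;> simp_all [Fin.sum_univ_four]
  -- A singular symmetric block annihilates the vector orthogonal to its first row, if that row is
  -- not zero.
  · refine ⟨![pderivAt 1 (pderivAt 0 f) q, -pderivAt 0 (pderivAt 0 f) q, 0, 0], fun hw => h0 ⟨?_, ?_⟩,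
      ?_, ?_⟩
    · simpa using congrFun hw 1
    · simpa using congrFun hw 0
    · intro i hi
      fin_cases i <;> simp_all
    · intro j hj
      fin_cases j
      · simp [Fin.sum_univ_four, hcomm]
        ring
      · simp [Fin.sum_univ_four]
        linarith
      · simp at hj
      · simp at hj

theorem mem_curveR_iff {f : ParamSpace → ℝ} {q : ParamSpace} : q ∈ curveR U f ↔
    q ∈ U ∧ ∀ i ∈ ({0, 1, 2} : Finset (Fin 4)), pderivAt i f q = 0 := by
  simp only [curveR, surfaceF, surfaceT, Set.mem_inter_iff, Set.mem_ofPred_eq]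
  simp
  tauto

namespace IsNondegenerate

variable {c₀ : ℝ} {f : ParamSpace → ℝ}

theorem regularT_of_mem (h : IsNondegenerate U c₀ f) {q : ParamSpace} (hq : q ∈ surfaceT U f) :
    RegularT f q := by
  intro h0
  have hp : ∀ j, pderivAt j (pderivAt 2 f) q = 0 := fun j => by
    rw [pderivAt, h0]
    rfl
  have := h.regularT.eq_zero hq.1 (by simp) (by simpa using hq.2) (w := Pi.single 2 1)
    (fun i hi => Pi.single_eq_of_ne (by simpa using hi) _)
    (fun j _ => by simp [Fin.sum_univ_four, hp])
  simpa using congrFun this 2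

theorem regularF_of_mem (h : IsNondegenerate U c₀ f) {q : ParamSpace} (hq : q ∈ surfaceF U f) :
    RegularF f q := by
  refine linearIndependent_of_sum_mul_apply_eq_zero fun w hw => ?_
  have := h.regularF.eq_zero hq.1 (by simp) (by simpa using hq.2) (w := ![w 0, w 1, 0, 0])
    (fun i hi => by fin_cases i <;> simp_all)
    (fun j _ => by
      simpa [Fin.sum_univ_four, Fin.sum_univ_two, pderivAt] using hw (EuclideanSpace.single j 1))
  ext i
  fin_cases i
  · exact congrFun this 0
  · exact congrFun this 1

theorem linearIndependent_of_mem_curveR (h : IsNondegenerate U c₀ f) {q : ParamSpace}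
    (hq : q ∈ curveR U f) : LinearIndependent ℝ
      ![fderiv ℝ (pderivAt 0 f) q, fderiv ℝ (pderivAt 1 f) q, fderiv ℝ (pderivAt 2 f) q] := by
  refine linearIndependent_of_sum_mul_apply_eq_zero fun w hw => ?_
  have := h.regularR.eq_zero hq.1.1 (by simp) (mem_curveR_iff.1 hq).2
    (w := ![w 0, w 1, w 2, 0])
    (fun i hi => by fin_cases i <;> simp_all)
    (fun j _ => by
      simpa [Fin.sum_univ_four, Fin.sum_univ_three, pderivAt] using hw (EuclideanSpace.single j 1))
  ext i
  fin_cases i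
  · exact congrFun this 0
  · exact congrFun this 1
  · exact congrFun this 2

theorem exists_forall_fderiv_eq (h : IsNondegenerate U c₀ f) {q : ParamSpace}
    (hq : q ∈ curveR U f) (r : Fin 3 → ℝ) : ∃ ξ, fderiv ℝ (pderivAt 0 f) q ξ = r 0 ∧
      fderiv ℝ (pderivAt 1 f) q ξ = r 1 ∧ fderiv ℝ (pderivAt 2 f) q ξ = r 2 := by
  obtain ⟨ξ, hξ⟩ := exists_forall_apply_eq _ (sum_mul_apply_eq_zero_of_linearIndependent
    (h.linearIndependent_of_mem_curveR hq)) r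
  exact ⟨ξ, hξ 0, hξ 1, hξ 2⟩

/-- Points of `R` with singular normal linearization are projections of zeros of the square system.
These are isolated, being regular, and compactness of the range of `w` gives one neighbourhood of
`q` that works for all `w`. -/
theorem eventually_normalDet_ne_zero (hU : IsOpen U) (hf : ContDiffOn ℝ ∞ f U)
    (h : IsNondegenerate U c₀ f) {q : ParamSpace} (hq : q ∈ U) :
    ∀ᶠ q' in 𝓝[≠] q, q' ∈ curveR U f → normalDet f q' ≠ 0 := by
  have hev : ∀ w ∈ Metric.closedBall (0 : Fin 4 → ℝ) 1, ∀ᶠ z : PointVec in 𝓝 (q, w),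
      degeneracyMap {0, 1} {0, 1, 2} {0, 1} ∅ 0 f z = 0 → z.1 = q := by
    intro w _
    have hd := differentiableAt_degeneracyMap hU {0, 1} {0, 1, 2} {0, 1} ∅ 0 hf (z := (q, w)) hq
    by_cases h0 : degeneracyMap {0, 1} {0, 1, 2} {0, 1} ∅ 0 f (q, w) = 0
    · have hinj := (injective_iff_map_eq_zero _).2 (h.normal (q, w) hq h0)
      -- An injective derivative in finite dimensions is bounded below, which excludes other zeros
      -- nearby.
      obtain ⟨M, -, hM⟩ := (LinearMap.injective_iff_antilipschitz
        (fderiv ℝ (degeneracyMap {0, 1} {0, 1, 2} {0, 1} ∅ 0 f) (q, w)).toLinearMap).1 hinj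
      have := hd.hasFDerivAt.eventually_ne ⟨M, hM⟩ (c := 0)
      filter_upwards [eventually_nhdsWithin_iff.1 this] with z hz hz0
      by_contra hne
      exact hz (fun hzq => hne (congrArg Prod.fst hzq)) hz0
    · filter_upwards [hd.continuousAt.eventually_ne h0] with z hz hz0
      exact absurd hz0 hz
  have := (isCompact_closedBall (0 : Fin 4 → ℝ) 1).eventually_forall_of_forall_eventually
    (P := fun q' w => degeneracyMap {0, 1} {0, 1, 2} {0, 1} ∅ 0 f (q', w) = 0 → q' = q) hev
  rw [eventually_nhdsWithin_iff]
  filter_upwards [this] with q' hq' hne hR h0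
  obtain ⟨w, hw, hI, hJ⟩ := exists_null_vector hU hf hR.1.1 h0
  obtain ⟨w', hw'⟩ := exists_degeneracyMap_eq_zero (C := ∅) (c := 0) (by simp)
    (mem_curveR_iff.1 hR).2 hI hJ hw
  exact hne (hq' w' (mem_closedBall_of_degeneracyMap_eq_zero hw') hw')

theorem isHyperbolicCircle_or_isEllipticCircle (hU : IsOpen U) (hf : ContDiffOn ℝ ∞ f U)
    {y : Base} {c : ℝ} (hR : joinParam y c ∈ curveR U f) (h : normalDet f (joinParam y c) ≠ 0) :
    IsHyperbolicCircle (phaseHamiltonian f c) y ∨ IsEllipticCircle (phaseHamiltonian f c) y := by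
  rw [isHyperbolicCircle_iff hU hf hR.1.1, isEllipticCircle_iff hU hf hR.1.1]
  rcases h.lt_or_gt with h | h
  · exact Or.inl ⟨hR, h⟩
  · exact Or.inr ⟨hR, h⟩

theorem goodGeometry (hU : IsOpen U) (hf : ContDiffOn ℝ ∞ f U) (h : IsNondegenerate U c₀ f) :
    GoodGeometry U f := by
  refine ⟨isEmbeddedSubmanifold_surfaceF hU hf fun q hq => h.regularF_of_mem hq,
    isEmbeddedSubmanifold_surfaceT hU hf fun q hq => h.regularT_of_mem hq,
    isEmbeddedSubmanifold_curveR hU hf fun q hq => h.linearIndependent_of_mem_curveR hq,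
    fun q hq => h.regularF_of_mem hq, fun q hq => h.regularT_of_mem hq,
    fun q hq => transverseFT_of_exists (h.exists_forall_fderiv_eq hq), fun q hq => ?_⟩
  filter_upwards [h.eventually_normalDet_ne_zero hU hf hq.1.1] with q' hq' hR y c hyc
  subst hyc
  exact isHyperbolicCircle_or_isEllipticCircle hU hf hR (hq' hR)

theorem goodLevel_of_forall (hU : IsOpen U) (hf : ContDiffOn ℝ ∞ f U) {c : ℝ}
    (h : ∀ q ∈ curveR U f, q 3 = c → (∀ ξ, (∀ i, levelDifferentials f q i ξ = 0) → ξ = 0) ∧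
      normalDet f q ≠ 0) : GoodLevel U f c := by
  intro y hy hfix
  have hR := (isFixedCircle_iff_mem_curveR hU hf hy).1 hfix
  obtain ⟨h1, h2⟩ := h _ hR (by simp [joinParam])
  exact ⟨transverseRC_iff.2 h1, isHyperbolicCircle_or_isEllipticCircle hU hf hR h2⟩

/-- On the directions `x`, `v`, `D` the differential of `c` vanishes, so a relation among the four
differentials restricts to one forbidden by `regularLevel`; the direction `c` then removes the
remaining coefficient. A singular normal block is forbidden by `normalLevel`. -/
theorem goodLevel (hU : IsOpen U) (hf : ContDiffOn ℝ ∞ f U) (h : IsNondegenerate U c₀ f) :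
    GoodLevel U f c₀ := by
  refine goodLevel_of_forall hU hf fun q hq hc => ⟨fun ξ hξ => ?_, fun h0 => ?_⟩
  · refine eq_zero_of_forall_apply_eq_zero _ (exists_forall_apply_eq _ fun w hw => ?_) hξ
    have hsum : ∀ ξ : ParamSpace, w 0 * fderiv ℝ (pderivAt 0 f) q ξ +
        w 1 * fderiv ℝ (pderivAt 1 f) q ξ + w 2 * fderiv ℝ (pderivAt 2 f) q ξ + w 3 * ξ 3 = 0 := by
      intro ξ
      have := hw ξ
      rw [Fin.sum_univ_four] at this
      exact this
    have h0 := h.regularLevel.eq_zero hq.1.1 (by simpa using hc) (mem_curveR_iff.1 hq).2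
      (w := ![w 0, w 1, w 2, 0]) (fun i hi => by fin_cases i <;> simp_all) (fun j hj => by
        have h3 : (EuclideanSpace.single j (1 : ℝ) : ParamSpace) 3 = 0 := by
          fin_cases j <;> simp_all
        have := hsum (EuclideanSpace.single j 1)
        rw [h3] at this
        simpa [Fin.sum_univ_four, pderivAt] using this)
    have h00 : w 0 = 0 := congrFun h0 0
    have h01 : w 1 = 0 := congrFun h0 1
    have h02 : w 2 = 0 := congrFun h0 2
    have h03 := hsum (EuclideanSpace.single 3 1)
    simp [h00, h01, h02] at h03
    ext i
    fin_cases i <;> assumption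
  · obtain ⟨w, hw, hI, hJ⟩ := exists_null_vector hU hf hq.1.1 h0
    exact hw (h.normalLevel.eq_zero hq.1.1 (by simpa using hc) (mem_curveR_iff.1 hq).2 hI hJ)

end IsNondegenerate

/-! ### Almost every level -/

section Level

variable {Z K : Type*} [NormedAddCommGroup Z] [NormedSpace ℝ Z] [NormedAddCommGroup K]
  [NormedSpace ℝ K]
  {O : Set Z} {κ : Z → K} (π : Z →L[ℝ] ℝ)

theorem contDiffOn_levelFamily (hκ : ContDiffOn ℝ 1 κ O) :
    ContDiffOn ℝ 1 (fun p : Z × ℝ => (κ p.1, π p.1 - p.2)) (O ×ˢ Set.univ) :=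
  (hκ.comp contDiffOn_fst fun p hp => hp.1).prodMk (ContDiff.contDiffOn (by fun_prop))

/-- The level `c` is now the parameter: it moves the last equation at rate `-1` and leaves `κ`
alone, which explains the direction `-k`. -/
theorem surjective_fderiv_levelFamily {z : Z} (hκ : DifferentiableAt ℝ κ z)
    (hs : Function.Surjective (fderiv ℝ κ z)) (c : ℝ) :
    Function.Surjective (fderiv ℝ (fun p : Z × ℝ => (κ p.1, π p.1 - p.2)) (z, c)) := by
  refine surjective_fderiv_of_partial ?_ (fun k => ?_) fun k => ⟨-k, ?_⟩
  · exact DifferentiableAt.prodMk (hκ.comp (z, c) differentiableAt_fst) (by fun_prop)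
  · obtain ⟨ζ, rfl⟩ := hs k
    refine ⟨ζ, ?_⟩
    have h1 : HasDerivAt (fun t : ℝ => z + t • ζ) ζ 0 := by
      simpa using ((hasDerivAt_id (0 : ℝ)).smul_const ζ).const_add z
    have h2 : HasFDerivAt κ (fderiv ℝ κ z) (z + (0 : ℝ) • ζ) := by
      simpa using hκ.hasFDerivAt
    exact h2.comp_hasDerivAt (0 : ℝ) h1
  · refine HasDerivAt.prodMk (hasDerivAt_const (0 : ℝ) (κ z)) ?_
    simpa using (((hasDerivAt_id (0 : ℝ)).mul_const (-k)).const_add c).const_sub (π z)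

variable [FiniteDimensional ℝ Z] [FiniteDimensional ℝ K]

/-- Almost every level of a linear functional is transverse to a regular curve. -/
theorem ae_level_transverse (hdim : Module.finrank ℝ Z = Module.finrank ℝ K + 1) (hO : IsOpen O)
    (hκ : ContDiffOn ℝ 1 κ O)
    (hs : ∀ z ∈ O, κ z = 0 → Function.Surjective (fderiv ℝ κ z)) :
    ∀ᵐ c : ℝ, ∀ z ∈ O, κ z = 0 → π z = c → ∀ ζ, fderiv ℝ κ z ζ = 0 → π ζ = 0 → ζ = 0 := by
  have hd : ∀ z ∈ O, DifferentiableAt ℝ κ z := fun z hz =>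
    (hκ.contDiffAt (hO.mem_nhds hz)).differentiableAt one_ne_zero
  have h := ae_nondegenerate (volume : Measure ℝ) (by simp [Module.finrank_prod, hdim]) hO
    (contDiffOn_levelFamily π hκ) fun z hz c h0 =>
      surjective_fderiv_levelFamily π (hd z hz) (hs z hz (congrArg Prod.fst h0)) c
  filter_upwards [h] with c hc z hz h0 hzc ζ hζ hπ
  refine hc z hz (by simp [h0, hzc]) ζ ?_
  have h1 : HasFDerivAt (fun p : Z × ℝ => (κ p.1, π p.1 - p.2)) _ (z, c) :=
    ((hd z hz).hasFDerivAt.comp (z, c) hasFDerivAt_fst).prodMk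
      ((π.hasFDerivAt.comp (z, c) hasFDerivAt_fst).sub hasFDerivAt_snd)
  rw [h1.fderiv]
  simp [hζ, hπ]

/-- Almost every level of a linear functional avoids the regular zeros of a map between spaces of
the same dimension. -/
theorem ae_level_avoids (hdim : Module.finrank ℝ Z = Module.finrank ℝ K) (hO : IsOpen O)
    (hκ : ContDiffOn ℝ 1 κ O)
    (hs : ∀ z ∈ O, κ z = 0 → Function.Surjective (fderiv ℝ κ z)) :
    ∀ᵐ c : ℝ, ∀ z ∈ O, κ z = 0 → π z ≠ c := by
  have h := ae_no_zero (volume : Measure ℝ) (by simp [Module.finrank_prod, hdim]) hO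
    (contDiffOn_levelFamily π hκ) fun z hz c h0 => surjective_fderiv_levelFamily π
      ((hκ.contDiffAt (hO.mem_nhds hz)).differentiableAt one_ne_zero)
      (hs z hz (congrArg Prod.fst h0)) c
  filter_upwards [h] with c hc z hz h0 hzc
  exact hc z hz (by simp [h0, hzc])

end Level

theorem contDiffOn_degeneracyMap (hU : IsOpen U) (I A J C : Finset (Fin 4)) (c : ℝ)
    {f : ParamSpace → ℝ} (hf : ContDiffOn ℝ ∞ f U) :
    ContDiffOn ℝ 1 (degeneracyMap I A J C c f) (U ×ˢ Set.univ) := by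
  refine ((contDiffOn_degeneracyFamily hU I A J C c hf).comp (t := (U ×ˢ Set.univ) ×ˢ Set.univ)
    (contDiff_prodMk_left (0 : QuadCoeff)).contDiffOn fun z hz => ⟨hz, trivial⟩).congr
    fun z _ => ?_
  simp [degeneracyFamily, degeneracyMap]

namespace IsNondegenerate

variable {c₀ : ℝ} {f : ParamSpace → ℝ}

/-- The singular points are governed by a square system with regular zeros; prescribing the level
adds a ninth equation. -/
theorem ae_normalDet_ne_zero (hU : IsOpen U) (hf : ContDiffOn ℝ ∞ f U)
    (h : IsNondegenerate U c₀ f) :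
    ∀ᵐ c : ℝ, ∀ q ∈ curveR U f, q 3 = c → normalDet f q ≠ 0 := by
  have hfin : Module.finrank ℝ PointVec =
      Module.finrank ℝ (DegValue {0, 1} {0, 1, 2} {0, 1} ∅) := by
    rw [finrank_pointVec, finrank_degValue]
    decide
  have hae := ae_level_avoids
    ((EuclideanSpace.proj 3 : ParamSpace →L[ℝ] ℝ).comp (ContinuousLinearMap.fst ℝ _ (Fin 4 → ℝ)))
    hfin (hU.prod isOpen_univ)
    (contDiffOn_degeneracyMap hU {0, 1} {0, 1, 2} {0, 1} ∅ 0 hf) fun z hz h0 =>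
      (LinearMap.injective_iff_surjective_of_finrank_eq_finrank
        (f := (fderiv ℝ (degeneracyMap {0, 1} {0, 1, 2} {0, 1} ∅ 0 f) z).toLinearMap) hfin).1
        ((injective_iff_map_eq_zero _).2 (h.normal z hz.1 h0))
  filter_upwards [hae] with c hc q hq hqc h0
  obtain ⟨w, hw, hI, hJ⟩ := exists_null_vector hU hf hq.1.1 h0
  obtain ⟨w', hw'⟩ := exists_degeneracyMap_eq_zero (C := ∅) (c := 0) (by simp)
    (mem_curveR_iff.1 hq).2 hI hJ hw
  exact hc (q, w') ⟨hq.1.1, trivial⟩ hw' hqc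

theorem ae_levelDifferentials (hU : IsOpen U) (hf : ContDiffOn ℝ ∞ f U)
    (h : IsNondegenerate U c₀ f) : ∀ᵐ c : ℝ, ∀ q ∈ curveR U f, q 3 = c →
      ∀ ξ, (∀ i, levelDifferentials f q i ξ = 0) → ξ = 0 := by
  let κ : ParamSpace → Fin 3 → ℝ := fun q i => pderivAt (Fin.castSucc i) f q
  have hκ : ContDiffOn ℝ 1 κ U := contDiffOn_pi.2 fun i =>
    (contDiffOn_pderivAt hU hf _).of_le (by exact_mod_cast le_top)
  have hd : ∀ q ∈ U, ∀ ξ i, fderiv ℝ κ q ξ i = fderiv ℝ (pderivAt (Fin.castSucc i) f) q ξ := by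
    intro q hq ξ i
    rw [fderiv_pi fun i => (contDiffOn_pderivAt hU hf _).differentiableAt_of_isOpen hU hq]
    rfl
  have hR : ∀ q ∈ U, κ q = 0 → q ∈ curveR U f := fun q hq h0 =>
    ⟨⟨hq, congrFun h0 0, congrFun h0 1⟩, hq, congrFun h0 2⟩
  have hae := ae_level_transverse (EuclideanSpace.proj 3 : ParamSpace →L[ℝ] ℝ) (by simp) hU hκ
    fun q hq h0 r => by
      obtain ⟨ξ, h1, h2, h3⟩ := h.exists_forall_fderiv_eq (hR q hq h0) r
      refine ⟨ξ, funext fun i => ?_⟩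
      rw [hd q hq]
      fin_cases i
      · exact h1
      · exact h2
      · exact h3
  filter_upwards [hae] with c hc q hq hqc ξ hξ
  refine hc q hq.1.1 (funext fun i => ?_) hqc ξ (funext fun i => ?_) (hξ 3)
  · fin_cases i
    · exact hq.1.2.1
    · exact hq.1.2.2
    · exact hq.2.2
  · rw [hd q hq.1.1]
    fin_cases i
    · exact hξ 0
    · exact hξ 1
    · exact hξ 2

theorem ae_goodLevel (hU : IsOpen U) (hf : ContDiffOn ℝ ∞ f U)
    (h : IsNondegenerate U c₀ f) : ∀ᵐ c : ℝ, GoodLevel U f c := by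
  filter_upwards [h.ae_normalDet_ne_zero hU hf, h.ae_levelDifferentials hU hf] with c h1 h2
  exact goodLevel_of_forall hU hf fun q hq hc => ⟨h2 q hq hc, h1 q hq hc⟩

end IsNondegenerate

theorem isGenericProperty_good (hU : IsOpen U) (c₀ : ℝ) :
    IsGenericProperty (fun H : IntegrableHam U =>
      GoodGeometry U H.1 ∧ GoodLevel U H.1 c₀ ∧ ∀ᵐ c : ℝ, GoodLevel U H.1 c) := by
  have hsub : {H : IntegrableHam U | IsNondegenerate U c₀ H.1} ⊆ {H : IntegrableHam U |
      GoodGeometry U H.1 ∧ GoodLevel U H.1 c₀ ∧ ∀ᵐ c : ℝ, GoodLevel U H.1 c} := fun H h =>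
    ⟨h.goodGeometry hU H.2, h.goodLevel hU H.2, h.ae_goodLevel hU H.2⟩
  exact ⟨mem_of_superset (residual_isNondegenerate hU c₀) hsub,
    (dense_isNondegenerate hU c₀).mono hsub⟩

/-! ### Occurrence and persistence of transverse circles -/

/-- The inclusion of the `(x, v, D)`-space. -/
def baseInclusion : Base →L[ℝ] ParamSpace :=
  LinearMap.toContinuousLinearMap
    { toFun := fun y => joinParam y 0
      map_add' := fun y y' => by
        ext i
        fin_cases i <;> simp [joinParam]
      map_smul' := fun s y => by
        ext i
        fin_cases i <;> simp [joinParam] }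

theorem joinParam_eq (y : Base) (c : ℝ) :
    joinParam y c = baseInclusion y + EuclideanSpace.single 3 c := by
  change _ = joinParam y 0 + _
  ext i
  fin_cases i <;> simp [joinParam]

/-- The equations of the circles of fixed points of the system with parameter `c`. -/
def criticalMap (f : ParamSpace → ℝ) (c : ℝ) (y : Base) : Fin 3 → ℝ :=
  fun i => pderivAt (Fin.castSucc i) f (joinParam y c)

/-- The derivative of `criticalMap`. -/
def criticalDeriv (f : ParamSpace → ℝ) (c : ℝ) (y : Base) : Base →L[ℝ] Fin 3 → ℝ :=
  ContinuousLinearMap.pi fun i =>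
    (fderiv ℝ (pderivAt (Fin.castSucc i) f) (joinParam y c)).comp baseInclusion

theorem hasFDerivAt_criticalMap (hU : IsOpen U) {f : ParamSpace → ℝ} (hf : ContDiffOn ℝ ∞ f U)
    {y : Base} {c : ℝ} (hy : joinParam y c ∈ U) :
    HasFDerivAt (criticalMap f c) (criticalDeriv f c y) y := by
  refine hasFDerivAt_pi.2 fun i => ?_
  have h1 : HasFDerivAt (fun y => joinParam y c) baseInclusion y := by
    simp_rw [joinParam_eq]
    exact baseInclusion.hasFDerivAt.add_const _
  exact HasFDerivAt.comp (f := fun y => joinParam y c) y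
    ((contDiffOn_pderivAt hU hf _).differentiableAt_of_isOpen hU hy).hasFDerivAt h1

theorem criticalMap_eq_zero_iff {f : ParamSpace → ℝ} {y : Base} {c : ℝ} (hy : joinParam y c ∈ U) :
    criticalMap f c y = 0 ↔ joinParam y c ∈ curveR U f := by
  simp [funext_iff, criticalMap, curveR, surfaceF, surfaceT, hy, Fin.forall_fin_succ, and_assoc]

/-- Vectors annihilated by the differential of `c` are exactly those coming from the `(x, v,
D)`-space. -/
theorem injective_criticalDeriv_iff {f : ParamSpace → ℝ} {y : Base} {c : ℝ} :
    Function.Injective (criticalDeriv f c y) ↔ TransverseRC f (joinParam y c) := by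
  rw [transverseRC_iff, injective_iff_map_eq_zero]
  constructor
  · intro h ξ hξ
    have h3 : ξ 3 = 0 := hξ 3
    have hξ' : ξ = baseInclusion !₂[ξ 0, ξ 1, ξ 2] := by
      change ξ = joinParam _ 0
      ext i
      fin_cases i <;> simp [joinParam, h3]
    rw [hξ', h !₂[ξ 0, ξ 1, ξ 2] (funext fun i => ?_), map_zero]
    change fderiv ℝ (pderivAt (Fin.castSucc i) f) (joinParam y c) (baseInclusion _) = 0
    rw [← hξ']
    fin_cases i
    · exact hξ 0
    · exact hξ 1
    · exact hξ 2
  · intro h η hη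
    have h0 : baseInclusion η = 0 := by
      refine h _ fun i => ?_
      fin_cases i
      · exact congrFun hη 0
      · exact congrFun hη 1
      · exact congrFun hη 2
      · change joinParam η 0 3 = 0
        simp [joinParam]
    ext i
    have := congrArg (fun ξ : ParamSpace => ξ (Fin.castSucc i)) h0
    fin_cases i <;> exact this

theorem continuousOn_criticalMap (hU : IsOpen U) (c : ℝ) :
    ContinuousOn (fun p : IntegrableHam U × Base => criticalMap p.1.1 c p.2)
      {p | joinParam p.2 c ∈ U} := by
  refine continuousOn_pi.2 fun i => ?_
  have hφ : Continuous fun p : IntegrableHam U × Base => (p.1, joinParam p.2 c) :=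
    continuous_fst.prodMk (continuous_joinParam.comp (continuous_snd.prodMk continuous_const))
  exact (continuousOn_pderivAt_joint hU _).comp hφ.continuousOn fun p hp => hp

theorem continuousOn_pderivAt_pderivAt_joinParam (hU : IsOpen U) (c : ℝ) (i j : Fin 4) :
    ContinuousOn (fun p : IntegrableHam U × Base =>
      pderivAt j (pderivAt i p.1.1) (joinParam p.2 c)) {p | joinParam p.2 c ∈ U} := by
  have hφ : Continuous fun p : IntegrableHam U × Base => (p.1, joinParam p.2 c) :=
    continuous_fst.prodMk (continuous_joinParam.comp (continuous_snd.prodMk continuous_const))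
  exact (continuousOn_pderivAt_pderivAt_joint hU i j).comp hφ.continuousOn fun p hp => hp

theorem continuousOn_criticalDeriv (hU : IsOpen U) (c : ℝ) :
    ContinuousOn (fun p : IntegrableHam U × Base => criticalDeriv p.1.1 c p.2)
      {p | joinParam p.2 c ∈ U} := by
  refine continuousOn_clm_apply.2 fun η => continuousOn_pi.2 fun i => ?_
  change ContinuousOn (fun p : IntegrableHam U × Base =>
    fderiv ℝ (pderivAt (Fin.castSucc i) p.1.1) (joinParam p.2 c) (baseInclusion η)) _
  simp_rw [fderiv_apply_eq_sum]
  exact continuousOn_finsetSum _ fun k _ => continuousOn_const.mul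
    (continuousOn_pderivAt_pderivAt_joinParam hU c _ k)

theorem continuousOn_normalDet (hU : IsOpen U) (c : ℝ) :
    ContinuousOn (fun p : IntegrableHam U × Base => normalDet p.1.1 (joinParam p.2 c))
      {p | joinParam p.2 c ∈ U} :=
  ((continuousOn_pderivAt_pderivAt_joinParam hU c 0 0).mul
    (continuousOn_pderivAt_pderivAt_joinParam hU c 1 1)).sub
    ((continuousOn_pderivAt_pderivAt_joinParam hU c 0 1).pow 2)

/-- Quantitative persistence of a regular zero. -/
theorem exists_zero_of_approx {X Y : Type*} [NormedAddCommGroup X] [NormedSpace ℝ X]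
    [CompleteSpace X] [NormedAddCommGroup Y] [NormedSpace ℝ Y] {g : X → Y}
    {g' : X → X →L[ℝ] Y} {x : X} {r : ℝ} (hr : 0 ≤ r) (e : X ≃L[ℝ] Y) {b : NNReal}
    (hd : ∀ y ∈ Metric.closedBall x r, HasFDerivAt g (g' y) y)
    (hb : ∀ y ∈ Metric.closedBall x r, ‖g' y - e‖ ≤ b)
    (hx : ‖g x‖ ≤ ((‖(e.symm : Y →L[ℝ] X)‖₊ : ℝ)⁻¹ - b) * r) :
    ∃ y ∈ Metric.closedBall x r, g y = 0 := by
  -- On the convex ball the mean value inequality turns the derivative bound into approximation by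
  -- `e`; then the image of the ball contains a ball about `g x`, of a radius large enough to reach
  -- zero.
  have happ : ApproximatesLinearOn g (e : X →L[ℝ] Y) (Metric.closedBall x r) b := by
    intro y hy z hz
    exact (convex_closedBall x r).norm_image_sub_le_of_norm_hasFDerivWithin_le'
      (fun p hp => (hd p hp).hasFDerivWithinAt) hb hz hy
  have hsurj := happ.surjOn_closedBall_of_nonlinearRightInverse e.toNonlinearRightInverse hr
    Set.Subset.rfl
  have hx' : ‖g x‖ ≤ ((e.toNonlinearRightInverse.nnnorm : ℝ)⁻¹ - b) * r := hx
  exact hsurj (by simpa [dist_eq_norm] using hx')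

variable {C : (PhaseSpace → ℝ) → Base → Prop} {σ : ℝ}

theorem eventually_isRobustCircle (hU : IsOpen U) {c : ℝ}
    (hC : ∀ (H : IntegrableHam U) (y : Base), joinParam y c ∈ U →
      (C (phaseHamiltonian H.1 c) y ↔ joinParam y c ∈ curveR U H.1 ∧
        0 < σ * normalDet H.1 (joinParam y c)))
    {H : IntegrableHam U} {y : Base} (hy : IsRobustCircle C U H.1 c y) {W : Set Base}
    (hW : W ∈ 𝓝 y) : ∀ᶠ H' : IntegrableHam U in 𝓝 H, ∃ y' ∈ W, IsRobustCircle C U H'.1 c y' := by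
  obtain ⟨hyU, hyC, hyT⟩ := hy
  rw [hC H y hyU] at hyC
  have hO : IsOpen {p : IntegrableHam U × Base | joinParam p.2 c ∈ U} :=
    hU.preimage (continuous_joinParam.comp (continuous_snd.prodMk continuous_const))
  have hp : {p : IntegrableHam U × Base | joinParam p.2 c ∈ U} ∈ 𝓝 (H, y) := hO.mem_nhds hyU
  have hinj := injective_criticalDeriv_iff.2 hyT
  obtain ⟨e, he⟩ := exists_equiv_of_injective (by simp) _ hinj
  set N : NNReal := ‖(e.symm : (Fin 3 → ℝ) →L[ℝ] Base)‖₊ with hN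
  have hN0 : 0 < N := by
    rw [hN]
    exact e.nnnorm_symm_pos
  have h1 := ((continuousOn_criticalDeriv hU c).continuousAt hp).eventually
    (ContinuousLinearMap.isOpen_injective.mem_nhds hinj)
  -- Of the margin `N⁻¹` allowed by the inverse of `e`, half is spent on variation of the
  -- derivative; the other half bounds the value at `y` in `h5`.
  have h2 : ∀ᶠ p : IntegrableHam U × Base in 𝓝 (H, y),
      ‖criticalDeriv p.1.1 c p.2 - e‖ < (N⁻¹ / 2 : NNReal) := by
    have hcont : ContinuousAt (fun p : IntegrableHam U × Base => ‖criticalDeriv p.1.1 c p.2 - e‖)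
        (H, y) := (((continuousOn_criticalDeriv hU c).continuousAt hp).sub continuousAt_const).norm
    refine hcont.eventually_lt continuousAt_const ?_
    change ‖criticalDeriv H.1 c y - e‖ < _
    rw [he, sub_self, norm_zero]
    positivity
  have h3 : ∀ᶠ p : IntegrableHam U × Base in 𝓝 (H, y),
      0 < σ * normalDet p.1.1 (joinParam p.2 c) :=
    continuousAt_const.eventually_lt
      (continuousAt_const.mul ((continuousOn_normalDet hU c).continuousAt hp)) hyC.2
  have h4 : ∀ᶠ p : IntegrableHam U × Base in 𝓝 (H, y), p.2 ∈ W :=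
    continuousAt_snd.eventually_mem hW
  have h0 : ∀ᶠ p : IntegrableHam U × Base in 𝓝 (H, y), joinParam p.2 c ∈ U := hp
  have hall := ((h0.and h1).and h2).and (h3.and h4)
  rw [nhds_prod_eq] at hall
  -- Joint continuity gives a product neighbourhood, so the radius `r` does not depend on the
  -- perturbed Hamiltonian.
  obtain ⟨P, hP, Q, hQ, hPQ⟩ := eventually_prod_iff.1 hall
  obtain ⟨r, hr, hrQ⟩ := Metric.nhds_basis_closedBall.mem_iff.1 hQ
  have h5 : ∀ᶠ H' : IntegrableHam U in 𝓝 H, ‖criticalMap H'.1 c y‖ < (N : ℝ)⁻¹ / 2 * r := by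
    have h6 : ContinuousAt (fun H' : IntegrableHam U => criticalMap H'.1 c y) H :=
      ContinuousAt.comp (f := fun H' : IntegrableHam U => (H', y))
        ((continuousOn_criticalMap hU c).continuousAt hp) (by fun_prop)
    refine h6.norm.eventually_lt continuousAt_const ?_
    rw [(criticalMap_eq_zero_iff hyU).2 hyC.1, norm_zero]
    positivity
  filter_upwards [hP, h5] with H' hH' hsmall
  have hgood := fun y' (hy' : y' ∈ Metric.closedBall y r) => hPQ hH' (hrQ hy')
  obtain ⟨y', hy', h0⟩ := exists_zero_of_approx hr.le e (g := criticalMap H'.1 c)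
    (fun z hz => hasFDerivAt_criticalMap hU H'.2 (hgood z hz).1.1.1)
    (fun z hz => (hgood z hz).1.2.le) (by
      refine hsmall.le.trans (le_of_eq ?_)
      rw [← hN]
      push_cast
      ring)
  obtain ⟨⟨⟨g1, g2⟩, -⟩, g3, g4⟩ := hgood y' hy'
  exact ⟨y', g4, g1, (hC H' y' g1).2 ⟨(criticalMap_eq_zero_iff g1).1 h0, g3⟩,
    injective_criticalDeriv_iff.1 g2⟩

/-- The matrix of second derivatives in the directions of `x`, `v` and `D`. -/
def baseHessian (f : ParamSpace → ℝ) (q : ParamSpace) : Matrix (Fin 3) (Fin 3) ℝ :=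
  Matrix.of fun i j => pderivAt (Fin.castSucc j) (pderivAt (Fin.castSucc i) f) q

theorem transverseRC_of_det_ne_zero {f : ParamSpace → ℝ} {q : ParamSpace}
    (h : (baseHessian f q).det ≠ 0) : TransverseRC f q := by
  refine transverseRC_iff.2 fun ξ hξ => ?_
  have h3 : ξ 3 = 0 := hξ 3
  have hmul : Matrix.mulVec (baseHessian f q) ![ξ 0, ξ 1, ξ 2] = 0 := by
    ext i
    have hi : fderiv ℝ (pderivAt (Fin.castSucc i) f) q ξ = 0 := by
      fin_cases i
      · exact hξ 0
      · exact hξ 1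
      · exact hξ 2
    rw [fderiv_apply_eq_sum, Fin.sum_univ_four, h3] at hi
    simp only [Matrix.mulVec, dotProduct, Fin.sum_univ_three, Pi.zero_apply]
    rw [← hi]
    simp [baseHessian]
    ring
  have h0 := Matrix.eq_zero_of_mulVec_eq_zero h hmul
  ext i
  fin_cases i
  · exact congrFun h0 0
  · exact congrFun h0 1
  · exact congrFun h0 2
  · exact h3

theorem exists_isRobustCircle {c : ℝ} (hσ : σ ≠ 0)
    (hC : ∀ (H : IntegrableHam U) (y : Base), joinParam y c ∈ U →
      (C (phaseHamiltonian H.1 c) y ↔ joinParam y c ∈ curveR U H.1 ∧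
        0 < σ * normalDet H.1 (joinParam y c)))
    {y : Base} (hy : joinParam y c ∈ U) : ∃ H : IntegrableHam U, IsRobustCircle C U H.1 c y := by
  -- Up to a constant the polynomial is half of `σ (x-x₀)² + (v-v₀)² + (D-D₀)²`; its normal
  -- determinant and its full Hessian determinant both equal `σ`.
  let d : Fin 4 → ℝ := ![σ, 1, 1, 0]
  let a : QuadCoeff := (fun i => -(d i * joinParam y c i), Matrix.diagonal d)
  have h1 : ∀ i, pderivAt i (quadPoly a) (joinParam y c) = 0 := by
    intro i
    rw [pderivAt_quadPoly]
    fin_cases i <;> simp [a, Fin.sum_univ_four, Matrix.diagonal]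
  have h2 : ∀ i j, pderivAt j (pderivAt i (quadPoly a)) (joinParam y c) =
      Matrix.diagonal d i j := by
    intro i j
    rw [pderivAt_pderivAt_quadPoly]
    by_cases hij : i = j
    · subst hij
      simp [a]
    · simp [a, Matrix.diagonal_apply_ne _ hij, Matrix.diagonal_apply_ne' _ hij]
  refine ⟨⟨quadPoly a, (contDiff_quadPoly a).contDiffOn⟩, hy, (hC _ y hy).2
    ⟨mem_curveR_iff.2 ⟨hy, fun i _ => h1 i⟩, ?_⟩, transverseRC_of_det_ne_zero ?_⟩
  · simp only [normalDet, h2]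
    simp [d, Matrix.diagonal]
    positivity
  · simp only [Matrix.det_fin_three, baseHessian, Matrix.of_apply, h2]
    simpa [d, Matrix.diagonal] using hσ

/-- Adding `ε (D-D₀)² / 2`, up to a constant, preserves the gradient at the point and the `(x,
v)`-block, and changes the Hessian determinant in `(x, v, D)` by `ε * normalDet`. -/
theorem mem_closure_isRobustCircle (hU : IsOpen U) {c : ℝ}
    (hC : ∀ (H : IntegrableHam U) (y : Base), joinParam y c ∈ U →
      (C (phaseHamiltonian H.1 c) y ↔ joinParam y c ∈ curveR U H.1 ∧
        0 < σ * normalDet H.1 (joinParam y c)))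
    {H : IntegrableHam U} {y : Base} (hy : joinParam y c ∈ U)
    (hyC : C (phaseHamiltonian H.1 c) y) :
    H ∈ closure {H' : IntegrableHam U | IsRobustCircle C U H'.1 c y} := by
  rw [hC H y hy] at hyC
  let q := joinParam y c
  let B : Fin 4 → Fin 4 → ℝ := fun i j => if i = 2 ∧ j = 2 then 1 else 0
  let a : QuadCoeff := (Pi.single 2 (-(q 2)), B)
  have h1 : ∀ (ε : ℝ) (i : Fin 4), pderivAt i (H.addQuad (ε • a)).1 q = pderivAt i H.1 q := by
    intro ε i
    rw [H.pderivAt_addQuad hU _ _ hy, add_eq_left]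
    fin_cases i <;> simp [a, q, B]
  have h2 : ∀ (ε : ℝ) (i j : Fin 4), pderivAt j (pderivAt i (H.addQuad (ε • a)).1) q =
      pderivAt j (pderivAt i H.1) q + ε * B i j := by
    intro ε i j
    rw [H.pderivAt_pderivAt_addQuad hU _ _ _ hy, add_right_inj]
    fin_cases i <;> fin_cases j <;> simp [a, B]
  have hnd : ∀ ε : ℝ, normalDet (H.addQuad (ε • a)).1 q = normalDet H.1 q := by
    intro ε
    simp [normalDet, h2, B]
  have hdet : ∀ ε : ℝ, (baseHessian (H.addQuad (ε • a)).1 q).det =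
      (baseHessian H.1 q).det + ε * normalDet H.1 q := by
    intro ε
    have hcomm := pderivAt_comm hU H.2 hy 0 1
    simp only [Matrix.det_fin_three, baseHessian, Matrix.of_apply, h2]
    simp [B, normalDet, q, hcomm]
    ring
  -- The determinant is affine in `ε` with slope `normalDet`, which is nonzero for a circle of
  -- either type.
  have hev : ∀ᶠ ε : ℝ in 𝓝[≠] 0, (baseHessian H.1 q).det + ε * normalDet H.1 q ≠ 0 := by
    have hd : HasDerivAt (fun ε : ℝ => (baseHessian H.1 q).det + ε * normalDet H.1 q)
        (normalDet H.1 q) 0 := by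
      simpa using ((hasDerivAt_id (0 : ℝ)).mul_const (normalDet H.1 q)).const_add
        (baseHessian H.1 q).det
    exact hd.eventually_ne (right_ne_zero_of_mul hyC.2.ne')
  have hlim : Tendsto (fun ε : ℝ => H.addQuad (ε • a)) (𝓝[≠] 0) (𝓝 H) := by
    refine (H.tendsto_addQuad hU).comp (tendsto_nhdsWithin_of_tendsto_nhds ?_)
    have : Continuous fun ε : ℝ => ε • a := by fun_prop
    simpa using this.tendsto 0
  refine mem_closure_of_tendsto hlim ?_
  filter_upwards [hev] with ε hε
  refine ⟨hy, (hC _ y hy).2 ⟨mem_curveR_iff.2 ⟨hy, fun i hi => ?_⟩, ?_⟩,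
    transverseRC_of_det_ne_zero ?_⟩
  · rw [h1]
    exact (mem_curveR_iff.1 hyC.1).2 i hi
  · rw [hnd]
    exact hyC.2
  · rw [hdet]
    exact hε

/-- Only the sign of `normalDet` distinguishes the two types: `σ = -1` gives hyperbolic circles, `σ
= 1` elliptic ones. -/
theorem occursGenerically_of_iff (hU : IsOpen U) {c : ℝ} (hσ : σ ≠ 0)
    (hC : ∀ (H : IntegrableHam U) (y : Base), joinParam y c ∈ U →
      (C (phaseHamiltonian H.1 c) y ↔ joinParam y c ∈ curveR U H.1 ∧
        0 < σ * normalDet H.1 (joinParam y c))) : OccursGenerically C U c :=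
  ⟨fun _ hy => exists_isRobustCircle hσ hC hy,
    fun _ _ hy _ hW => eventually_isRobustCircle hU hC hy hW,
    fun _ _ hy hyC => mem_closure_isRobustCircle hU hC hy hyC⟩

end

theorem lemma1 (U : Set ParamSpace) (hU : IsOpen U) (c₀ : ℝ) :
    IsGenericProperty (fun H : IntegrableHam U =>
      GoodGeometry U H.1 ∧ GoodLevel U H.1 c₀ ∧ ∀ᵐ c : ℝ, GoodLevel U H.1 c) ∧
    OccursGenerically IsHyperbolicCircle U c₀ ∧
    OccursGenerically IsEllipticCircle U c₀ := by
  refine ⟨isGenericProperty_good hU c₀, occursGenerically_of_iff (σ := -1) hU (by norm_num)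
    fun H y hy => ?_, occursGenerically_of_iff (σ := 1) hU one_ne_zero fun H y hy => ?_⟩
  · simpa using isHyperbolicCircle_iff hU H.2 hy
  · simpa using isEllipticCircle_iff hU H.2 hy
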